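/- Let $r\ge 1$ be an odd integer, $\nu>\frac{r-1}{2}$, $\omega=e^{2\pi i/r}$, $\varepsilon=e^{\pi i/r}$, and let $\delta=\bigcup_{j=0}^{r-1}\omega^j\mathbb{R}\subset\mathbb{C}$ be the union of the $r$ radial lines. Let $L^2_\nu(\delta)$ be the Hilbert space of (classes of) measurable functions on $\delta$ with inner product $$\langle f,g\rangle_\nu=\sum_{j=0}^{r-1}\int_{\mathbb{R}}f(\omega^jt)\overline{g(\omega^jt)}\,|t|^{2\nu}\,dt .$$ For $0\le i<2r$ put $(\Pi_i f)(x)=\frac1{2r}\sum_{k=0}^{2r-1}\varepsilon^{-ik}f(\varepsilon^kx)$, and for $x\neq 0$ in $\delta$ $$Y_\nu f(x)=\frac{1}{rx^{r-1}}f'(x)+\frac1{rx^r}\sum_{s=0}^{r-1}\big((2\nu+1+s-r)\,\Pi_{r+s}f(x)-s\,\Pi_sf(x)\big),$$ where $f'$ is the derivative along the lines, $f'(\omega^jt)=\omega^{-j}\frac{d}{dt}f(\omega^jt)$. Let $\mathcal{S}(\delta)$ be the space of functions $f:\delta\to\mathbb{C}$ of the form $f(x)=\sum_{j=0}^{r-1}x^j\varphi_j(x^r)$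 with Schwartz functions $\varphi_0,\dots,\varphi_{r-1}\in\mathcal{S}(\mathbb{R})$ (note that $x^r\in\mathbb{R}$ for $x\in\delta$); equivalently, each component $\frac1r\sum_{k=0}^{r-1}\omega^{-jk}f(\omega^kx)$, $0\le j<r$, is of the form $x^j\varphi_j(x^r)$ with $\varphi_j\in\mathcal{S}(\mathbb{R})$. For $N=nr+s$ with $0\le s<r$ let $\nu_s=\frac{2\nu+2s+1-r}{2r}$, let $[N]_\nu=n$ if $n$ is even and $[N]_\nu=n+2\nu_s$ if $n$ is odd, and let $$h_N^{(r,\nu)}(x)=\gamma_N^{-1/2}\,e^{-x^{2r}/2}\,x^sH_n^{(\nu_s)}(x^r),\qquad \gamma_N=2^{2n}\,\Gamma\big(\lfloor\tfrac n2\rfloor+1\big)\,\Gamma\big(\lfloor\tfrac{n+1}2\rfloor+\nu_s+\tfrac12\big),$$ where $H^{(\mu)}_{2m}(u)=(-1)^m2^{2m}m!\,L_m^{\mu-1/2}(u^2)$ and $H^{(\mu)}_{2m+1}(u)=(-1)^m2^{2m+1}m!\,u\,L_m^{\mu+1/2}(u^2)$ are the generalized Hermite polynomials, $L_m^\alpha$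 being the Laguerre polynomials. Then $H=-\frac12Y_\nu^2+\frac12x^{2r}$ with domain $D(H)=\mathcal{S}(\delta)$ is a well-defined operator in $L^2_\nu(\delta)$, and it is essentially self-adjoint. The spectrum of its closure $\overline H$ is purely discrete (each point of it is isolated and is an eigenvalue of finite multiplicity) and equals $$\Big\{\tfrac12\big([N]_\nu+[N+r]_\nu\big):N=0,1,2,\dots\Big\}.$$ The Hermite functions $h_N^{(r,\nu)}$, $N\ge0$, form a complete orthonormal system in $L^2_\nu(\delta)$; they belong to $D(H)$ and satisfy $Hh_N^{(r,\nu)}=\frac12([N]_\nu+[N+r]_\nu)h_N^{(r,\nu)}$, and the eigenspace of $\overline H$ for the eigenvalue $\frac12([N]_\nu+[N+r]_\nu)$ is spanned by $h_N^{(r,\nu)}$. -/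

import Mathlib

/-!  Unbounded operators on a complex Hilbert space. -/

namespace UnboundedOperator

variable {E : Type*} [NormedAddCommGroup E] [InnerProductSpace ℂ E]

/-- A densely defined symmetric operator is essentially self-adjoint if its closure is
self-adjoint. -/
def IsEssentiallySelfAdjoint [CompleteSpace E] (T : E →ₗ.[ℂ] E) : Prop :=
  Dense (T.domain : Set E) ∧ T.IsFormalAdjoint T ∧ IsSelfAdjoint T.closure

/-- `z` is in the resolvent set of `T` if `T - z` is a bijection from the domain of `T` onto `E`
with a bounded inverse. -/
def resolventSet (T : E →ₗ.[ℂ] E) : Set ℂ :=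
  {z | ∃ R : E →L[ℂ] E,
    (∀ y : E, ∃ h : R y ∈ T.domain, T ⟨R y, h⟩ - z • R y = y) ∧
    ∀ x : T.domain, R (T x - z • (x : E)) = x}

/-- The spectrum of an unbounded operator. -/
def spectrum (T : E →ₗ.[ℂ] E) : Set ℂ := (resolventSet T)ᶜ

/-- The space of all `x` in the domain of `T` with `T x = z x`. -/
def eigenspace (T : E →ₗ.[ℂ] E) (z : ℂ) : Submodule ℂ E where
  carrier := {x | ∃ h : x ∈ T.domain, T ⟨x, h⟩ = z • x}
  zero_mem' := ⟨T.domain.zero_mem, by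
    have h : (⟨0, T.domain.zero_mem⟩ : T.domain) = 0 := rfl
    rw [h, T.map_zero, smul_zero]⟩
  add_mem' := by
    rintro x y ⟨hx, hx'⟩ ⟨hy, hy'⟩
    refine ⟨T.domain.add_mem hx hy, ?_⟩
    have h : (⟨x + y, T.domain.add_mem hx hy⟩ : T.domain) = ⟨x, hx⟩ + ⟨y, hy⟩ := rfl
    rw [h, T.map_add, hx', hy', smul_add]
  smul_mem' := by
    rintro c x ⟨hx, hx'⟩
    refine ⟨T.domain.smul_mem c hx, ?_⟩
    have h : (⟨c • x, T.domain.smul_mem c hx⟩ : T.domain) = c • ⟨x, hx⟩ := rfl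
    rw [h, T.map_smul, hx', smul_comm]

/-- The spectrum is purely discrete: each of its points is isolated in the spectrum and is an
eigenvalue of finite multiplicity. -/
def HasPurelyDiscreteSpectrum (T : E →ₗ.[ℂ] E) : Prop :=
  ∀ z ∈ spectrum T,
    (∃ ε > 0, ∀ w ∈ spectrum T, w ≠ z → ε ≤ dist w z) ∧
    eigenspace T z ≠ ⊥ ∧ FiniteDimensional ℂ (eigenspace T z)

end UnboundedOperator

/-!  The radial lines `δ = ⋃ ω ^ j ℝ`, `0 ≤ j < r`, with `ω = exp (2πi / r)` and `r` odd.

A function on `δ` is represented by a function `ℂ → ℂ` of which only the values on `δ` matter: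
everything below evaluates it at points of `δ` only, as `r` is odd. -/

namespace RadialLines

open MeasureTheory Polynomial

noncomputable section

/-- The root of unity `ω_r = exp (2πi / r)`. -/
def omega (r : ℕ) : ℂ := Complex.exp (2 * Real.pi * Complex.I / r)

/-- The root of unity `ε_r = exp (πi / r)`. -/
def eps (r : ℕ) : ℂ := Complex.exp (Real.pi * Complex.I / r)

/-- The measure on the lines that gives
`∫ f = ∑ j < r, ∫ t : ℝ, f (ω ^ j * t) * |t| ^ (2 * ν)`;
it lives on `ℂ` and is concentrated on `δ`. -/
def lineMeasure (r : ℕ) (ν : ℝ) : Measure ℂ :=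
  ∑ j ∈ Finset.range r,
    ((volume : Measure ℝ).withDensity (fun t => ENNReal.ofReal (|t| ^ (2 * ν)))).map
      (fun t : ℝ => omega r ^ j * (t : ℂ))

/-- The Hilbert space `L²_ν(δ)`. -/
abbrev L2 (r : ℕ) (ν : ℝ) : Type := Lp ℂ 2 (lineMeasure r ν)

/-- The projection `Π_j(r)` attached to the rotation `x ↦ ω x` of order `r`. -/
def sectorProj (r j : ℕ) (f : ℂ → ℂ) (x : ℂ) : ℂ :=
  (1 / (r : ℂ)) * ∑ k ∈ Finset.range r, (omega r ^ (j * k))⁻¹ * f (omega r ^ k * x)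

/-- The projection `Π_i(2r)` attached to the rotation `x ↦ ε x` of order `2r`. -/
def reflProj (r i : ℕ) (f : ℂ → ℂ) (x : ℂ) : ℂ :=
  (1 / (2 * r : ℂ)) *
    ∑ k ∈ Finset.range (2 * r), (eps r ^ (i * k))⁻¹ * f (eps r ^ k * x)

/-- The Schwartz space `S(δ)`: every component `f_j = Π_j(r) f` has the form
`f_j(x) = x ^ j φ_j(x ^ r)` with a Schwartz function `φ_j` on the real line. As
`f_j(ω x) = ω ^ j f_j(x)`, it is enough to say this for real `x`. -/
def schwartzSpace (r : ℕ) : Submodule ℂ (ℂ → ℂ) where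
  carrier := {f | ∀ j < r, ∃ φ : SchwartzMap ℝ ℂ,
    ∀ t : ℝ, sectorProj r j f (t : ℂ) = (t : ℂ) ^ j * φ (t ^ r)}
  zero_mem' := fun j _ => ⟨0, fun t => by simp [sectorProj]⟩
  add_mem' := by
    intro f g hf hg j hj
    obtain ⟨φ, hφ⟩ := hf j hj
    obtain ⟨ψ, hψ⟩ := hg j hj
    refine ⟨φ + ψ, fun t => ?_⟩
    rw [add_apply, mul_add, ← hφ t, ← hψ t]
    simp only [sectorProj, Pi.add_apply, mul_add, Finset.sum_add_distrib]
  smul_mem' := by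
    intro c f hf j hj
    obtain ⟨φ, hφ⟩ := hf j hj
    refine ⟨c • φ, fun t => ?_⟩
    rw [smul_apply, smul_eq_mul, mul_left_comm, ← hφ t]
    simp only [sectorProj, Pi.smul_apply, smul_eq_mul, Finset.mul_sum]
    exact Finset.sum_congr rfl fun k _ => by ring

/-- The derivative `df/dx` along the line through `0` and `x ≠ 0`: the limit of
`(f (x + h x) - f x) / (h x)` for real `h → 0`. -/
def alongDeriv (f : ℂ → ℂ) (x : ℂ) : ℂ := lineDeriv ℝ f x x / x

/-- The Dunkl-type operator
`Y_ν = d/dx^r + (1 / (r x^r)) ∑ s < r, ((2ν + 1 + s - r) Π_{r+s}(2r) - s Π_s(2r))`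
with `d/dx^r = (1 / (r x^(r-1))) d/dx`, at the points `x ≠ 0`. (The value at the null set `{0}`
is irrelevant and is not used at other points.) -/
def dunklOp (r : ℕ) (ν : ℝ) (f : ℂ → ℂ) (x : ℂ) : ℂ :=
  1 / (r * x ^ (r - 1)) * alongDeriv f x +
    1 / (r * x ^ r) * ∑ s ∈ Finset.range r,
      (((2 * ν + 1 + s - r : ℝ) : ℂ) * reflProj r (r + s) f x - (s : ℂ) * reflProj r s f x)

/-- The expression `-(1/2) Y_ν² + (1/2) x^(2r)`. -/
def hamiltonianExpr (r : ℕ) (ν : ℝ) (f : ℂ → ℂ) (x : ℂ) : ℂ :=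
  -(1 / 2) * dunklOp r ν (dunklOp r ν f) x + (1 / 2) * x ^ (2 * r) * f x

/-- `H` is the operator in `L²_ν(δ)` with domain exactly `S(δ)` that maps the class of each
`f ∈ S(δ)` to the class of `-(1/2) Y_ν² f + (1/2) x^(2r) f`. There is at most one such operator. -/
structure IsHamiltonian (r : ℕ) (ν : ℝ) (H : L2 r ν →ₗ.[ℂ] L2 r ν) : Prop where
  domain_le : ∀ F ∈ H.domain, ∃ f ∈ schwartzSpace r, (F : ℂ → ℂ) =ᵐ[lineMeasure r ν] f
  acts : ∀ f ∈ schwartzSpace r, ∃ F : H.domain,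
    ((F : L2 r ν) : ℂ → ℂ) =ᵐ[lineMeasure r ν] f ∧
    ((H F : L2 r ν) : ℂ → ℂ) =ᵐ[lineMeasure r ν] hamiltonianExpr r ν f

/-- The parameter `ν_s = (2ν + 2s + 1 - r) / (2r)`. -/
def nuParam (r : ℕ) (ν : ℝ) (s : ℕ) : ℝ := (2 * ν + 2 * s + 1 - r) / (2 * r)

/-- The deformed number `[N]_ν = [N/r] + ϑ_N`, where `ϑ_N = 0` for `N = 2nr + s` and
`ϑ_N = 2 ν_s` for `N = 2nr + r + s`, `0 ≤ s < r`. -/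
def deformedNumber (r : ℕ) (ν : ℝ) (N : ℕ) : ℝ :=
  ((N / r : ℕ) : ℝ) + if Even (N / r) then 0 else 2 * nuParam r ν (N % r)

/-- The Laguerre polynomial
`L_n^α(x) = ∑ k ≤ n, (-1)^k (α+k+1)⋯(α+n) / ((n-k)! k!) x^k`. -/
def laguerre (α : ℝ) (n : ℕ) : ℝ[X] :=
  ∑ k ∈ Finset.range (n + 1),
    C ((-1) ^ k * (∏ i ∈ Finset.Ioc k n, (α + i)) / ((n - k).factorial * k.factorial : ℝ)) * X ^ k

/-- The generalized Hermite polynomials on the real line,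
`H_{2m} = (-1)^m 2^{2m} m! L_m^{μ-1/2}(x²)` and
`H_{2m+1} = (-1)^m 2^{2m+1} m! x L_m^{μ+1/2}(x²)`. -/
def genHermite (μ : ℝ) (n : ℕ) : ℝ[X] :=
  C ((-1) ^ (n / 2) * 2 ^ n * ((n / 2).factorial : ℝ)) *
    if Even n then (laguerre (μ - 1 / 2) (n / 2)).comp (X ^ 2)
    else X * (laguerre (μ + 1 / 2) (n / 2)).comp (X ^ 2)

/-- The Hermite polynomials on the radial lines,
`H_N(x) = x^s H_n^{(ν_s)}(x^r)` for `N = nr + s`, `0 ≤ s < r`. -/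
def radialHermite (r : ℕ) (ν : ℝ) (N : ℕ) : ℝ[X] :=
  X ^ (N % r) * (genHermite (nuParam r ν (N % r)) (N / r)).comp (X ^ r)

/-- The squared norm of `H_N` for the weight `|x|^{2ν} exp (-x^{2r})`:
`2^{2[N/r]} Γ([N/(2r)] + 1) Γ([(N+r)/(2r)] + ν_s + 1/2)`, `s = N mod r`. -/
def hermiteNormSq (r : ℕ) (ν : ℝ) (N : ℕ) : ℝ :=
  2 ^ (2 * (N / r)) * Real.Gamma ((N / (2 * r) : ℕ) + 1) *
    Real.Gamma (((N + r) / (2 * r) : ℕ) + nuParam r ν (N % r) + 1 / 2)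

/-- The normalized Hermite functions `h_N` on the radial lines. -/
def hermiteFunction (r : ℕ) (ν : ℝ) (N : ℕ) (x : ℂ) : ℂ :=
  ((1 / Real.sqrt (hermiteNormSq r ν N) : ℝ) : ℂ) * Complex.exp (-x ^ (2 * r) / 2) *
    aeval x (radialHermite r ν N)

/-- The number `([N]_ν + [N+r]_ν) / 2`. -/
def energy (r : ℕ) (ν : ℝ) (N : ℕ) : ℝ :=
  (deformedNumber r ν N + deformedNumber r ν (N + r)) / 2

end

end RadialLines

/-! The theorem separates into a one-dimensional problem and an abstract one.

Write `f(x) = ∑ x^j φ_j(x^r)`. Since `r` is odd, the points with `x^r` real are exactly those of the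
lines, and the rotation by `ε` sends `x^r` to `-x^r`, so the projections `Π_i(2r)` separate the even
and odd parts of the `φ_j`. The terms of `Y_ν` are balanced so that `φ_j` undergoes the Dunkl
operator `D φ = φ' + ν_j (φ(u) - φ(-u)) / u` (`HasComponents.dunklOp`), while the substitution `u =
t^r` turns the weight `|t|^(2ν)` on `x^j φ_j` into `|u|^(2ν_j)` (`integral_weightMeasure_comp_pow`).
Hence `H` is a direct sum of `r` Dunkl oscillators `(-D² + u²) / 2`. Division of a Schwartz function
vanishing at `0` by the variable keeps `D` inside the Schwartz space.

Each oscillator is solved by ladder operators. `D` is antisymmetric, and `[D, u] = 1 + 2μR` with the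
reflection `R`; so `u - D` generates eigenfunctions from the Gaussian, `u + D` undoes it up to a
deformed integer, and norms and eigenvalues follow. The recurrence of the Laguerre polynomials
identifies this ladder with the generalized Hermite functions. Completeness is a moment argument: a
function orthogonal to the ladder is orthogonal to every polynomial times the Gaussian, so a Fourier
transform vanishes (`ae_eq_zero_of_moments`).

Finally, symmetry gives `⟨h_N, H f⟩ = E_N ⟨h_N, f⟩` for all `f` in the domain, so the graph of `H`
lies in that of the maximal operator diagonal in the basis `h_N`. The `h_N` lie in the domain, so
the closure is that maximal operator, which is self-adjoint because the `E_N` are real. As `E_N = (N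
+ ν + 1/2) / r`, the eigenvalues are simple and have uniform gaps, so the spectrum consists of them
alone. -/

namespace UnboundedOperator

/-! ### Operators diagonal in a Hilbert basis -/

variable {E : Type*} [NormedAddCommGroup E] [InnerProductSpace ℂ E]

/-- The graph of the maximal operator that is diagonal in a Hilbert basis. -/
def diagonalGraph (b : HilbertBasis ℕ ℂ E) (a : ℕ → ℝ) : Submodule ℂ (E × E) where
  carrier := {p | ∀ n, b.repr p.2 n = (a n : ℂ) * b.repr p.1 n}
  zero_mem' := fun n => by simp
  add_mem' := by
    intro p q hp hq n
    simp [hp n, hq n, mul_add]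
  smul_mem' := by
    intro c p hp n
    simp [hp n, mul_left_comm]

theorem mem_diagonalGraph {b : HilbertBasis ℕ ℂ E} {a : ℕ → ℝ} {p : E × E} :
    p ∈ diagonalGraph b a ↔ ∀ n, b.repr p.2 n = (a n : ℂ) * b.repr p.1 n := Iff.rfl

theorem isClosed_diagonalGraph (b : HilbertBasis ℕ ℂ E) (a : ℕ → ℝ) :
    IsClosed (diagonalGraph b a : Set (E × E)) := by
  have h : (diagonalGraph b a : Set (E × E)) =
      ⋂ n, {p | b.repr p.2 n = (a n : ℂ) * b.repr p.1 n} := by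
    ext p
    simp [mem_diagonalGraph]
  rw [h]
  refine isClosed_iInter fun n => isClosed_eq ?_ ?_
  · simp only [HilbertBasis.repr_apply_apply]
    fun_prop
  · simp only [HilbertBasis.repr_apply_apply]
    fun_prop

theorem eq_of_repr_eq (b : HilbertBasis ℕ ℂ E) {x y : E} (h : ∀ n, b.repr x n = b.repr y n) :
    x = y :=
  b.repr.injective (lp.ext (funext h))

/-- The maximal operator that is diagonal in a Hilbert basis. -/
noncomputable def diagonalOp (b : HilbertBasis ℕ ℂ E) (a : ℕ → ℝ) : E →ₗ.[ℂ] E :=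
  (diagonalGraph b a).toLinearPMap

theorem diagonalOp_graph (b : HilbertBasis ℕ ℂ E) (a : ℕ → ℝ) :
    (diagonalOp b a).graph = diagonalGraph b a := by
  refine Submodule.toLinearPMap_graph_eq _ fun p hp h0 => eq_of_repr_eq b fun n => ?_
  rw [hp n, h0]
  simp

theorem repr_self_of_ne (b : HilbertBasis ℕ ℂ E) {n m : ℕ} (h : n ≠ m) : b.repr (b n) m = 0 := by
  rw [b.repr_self, lp.single_apply_ne _ _ _ h.symm]

theorem repr_self_self (b : HilbertBasis ℕ ℂ E) (n : ℕ) : b.repr (b n) n = 1 := by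
  rw [b.repr_self, lp.single_apply_self]

theorem basis_mem_diagonalGraph (b : HilbertBasis ℕ ℂ E) (a : ℕ → ℝ) (n : ℕ) :
    (b n, (a n : ℂ) • b n) ∈ diagonalGraph b a := by
  intro m
  change b.repr ((a n : ℂ) • b n) m = (a m : ℂ) * b.repr (b n) m
  rw [map_smul, lp.coeFn_smul, Pi.smul_apply, smul_eq_mul]
  rcases eq_or_ne n m with rfl | h
  · rfl
  · rw [repr_self_of_ne b h, mul_zero, mul_zero]

theorem inner_eq_of_mem_diagonalGraph {b : HilbertBasis ℕ ℂ E} {a : ℕ → ℝ} {p q : E × E}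
    (hp : p ∈ diagonalGraph b a) (hq : q ∈ diagonalGraph b a) :
    inner ℂ p.2 q.1 = inner ℂ p.1 q.2 := by
  rw [← b.repr.inner_map_map, ← b.repr.inner_map_map, lp.inner_eq_tsum, lp.inner_eq_tsum]
  refine tsum_congr fun n => ?_
  rw [hp n, hq n]
  simp only [RCLike.inner_apply, map_mul, Complex.conj_ofReal]
  ring

section

variable {T : E →ₗ.[ℂ] E} {b : HilbertBasis ℕ ℂ E} {a : ℕ → ℝ}

theorem isClosable_of_le_diagonal (hT : T.graph ≤ diagonalGraph b a) : T.IsClosable := by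
  rw [LinearPMap.isClosable_iff_exists_closed_extension]
  refine ⟨diagonalOp b a, ?_, LinearPMap.le_of_le_graph (by rwa [diagonalOp_graph])⟩
  rw [LinearPMap.IsClosed, diagonalOp_graph]
  exact isClosed_diagonalGraph b a

/-- The expansions of `x` and `y` in the basis converge jointly in `E × E`, and for a pair in the
diagonal graph the partial sums are combinations of the eigenpairs `(b n, a n • b n)`. So the
eigenpairs form a core. -/
theorem closure_graph_eq_diagonalGraph (hT : T.graph ≤ diagonalGraph b a)
    (hb : ∀ n, (b n, (a n : ℂ) • b n) ∈ T.graph) : T.closure.graph = diagonalGraph b a := by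
  rw [← (isClosable_of_le_diagonal hT).graph_closure_eq_closure_graph]
  refine le_antisymm (Submodule.topologicalClosure_minimal _ hT (isClosed_diagonalGraph b a)) ?_
  rintro ⟨x, y⟩ h
  have hs : HasSum (fun n => (b.repr x n • b n, b.repr y n • b n)) (x, y) :=
    (b.hasSum_repr x).prodMk (b.hasSum_repr y)
  refine mem_closure_of_tendsto hs (Filter.Eventually.of_forall fun s => ?_)
  refine Submodule.sum_mem _ fun n _ => ?_
  have h1 : (b.repr x n • b n, b.repr y n • b n) = b.repr x n • (b n, (a n : ℂ) • b n) := by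
    rw [h n, Prod.smul_mk, smul_smul, mul_comm]
  rw [h1]
  exact Submodule.smul_mem _ _ (hb n)

theorem dense_domain_of_basis_mem (hb : ∀ n, b n ∈ T.domain) : Dense (T.domain : Set E) := by
  have h : Submodule.span ℂ (Set.range b) ≤ T.domain := by
    rw [Submodule.span_le]
    rintro _ ⟨n, rfl⟩
    exact hb n
  refine Dense.mono h ?_
  rw [Submodule.dense_iff_topologicalClosure_eq_top]
  exact b.dense_span

theorem isEssentiallySelfAdjoint_of_diagonal [CompleteSpace E]
    (hT : T.graph ≤ diagonalGraph b a) (hb : ∀ n, (b n, (a n : ℂ) • b n) ∈ T.graph) :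
    IsEssentiallySelfAdjoint T := by
  have hd : Dense (T.domain : Set E) :=
    dense_domain_of_basis_mem fun n => LinearPMap.mem_domain_of_mem_graph (hb n)
  have hg := closure_graph_eq_diagonalGraph hT hb
  have hd' : Dense (T.closure.domain : Set E) := hd.mono T.le_closure.1
  refine ⟨hd, fun x y => ?_, ?_⟩
  · exact inner_eq_of_mem_diagonalGraph (hT (T.mem_graph x)) (hT (T.mem_graph y))
  · rw [LinearPMap.isSelfAdjoint_def]
    refine LinearPMap.eq_of_eq_graph ?_
    rw [LinearPMap.adjoint_graph_eq_graph_adjoint hd', hg]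
    ext ⟨x, y⟩
    rw [Submodule.mem_adjoint_iff]
    constructor
    · intro h n
      -- Testing the adjoint relation on the eigenpairs alone already determines every coordinate;
      -- that `a n` is real removes the conjugate.
      have h1 := h _ _ (basis_mem_diagonalGraph b a n)
      simp only [inner_smul_left, Complex.conj_ofReal, sub_eq_zero] at h1
      rw [b.repr_apply_apply, b.repr_apply_apply, h1]
    · intro h u v huv
      rw [sub_eq_zero]
      exact inner_eq_of_mem_diagonalGraph huv h

/-- The operator that is diagonal in a Hilbert basis with the given bounded entries. -/
theorem exists_diagonal_clm (b : HilbertBasis ℕ ℂ E) (d : ℕ → ℂ) {C : ℝ} (hC : 0 ≤ C)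
    (hd : ∀ n, ‖d n‖ ≤ C) :
    ∃ R : E →L[ℂ] E, ∀ y n, b.repr (R y) n = d n * b.repr y n := by
  have hb : ∀ (y : E) (n : ℕ), ‖d n * b.repr y n‖ ≤
      ‖(((C : ℂ) • b.repr y : lp (fun _ => ℂ) 2) : ℕ → ℂ) n‖ := by
    intro y n
    simp only [lp.coeFn_smul, Pi.smul_apply, smul_eq_mul, norm_mul, Complex.norm_real,
      Real.norm_of_nonneg hC]
    exact mul_le_mul_of_nonneg_right (hd n) (norm_nonneg _)
  have hm : ∀ y : E, Memℓp (fun n => d n * b.repr y n) 2 := fun y =>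
    (lp.memℓp ((C : ℂ) • b.repr y)).mono' (hb y)
  let R : E →ₗ[ℂ] E :=
    { toFun := fun y => b.repr.symm ⟨_, hm y⟩
      map_add' := fun x y => by
        refine eq_of_repr_eq b fun n => ?_
        simp [mul_add]
        rfl
      map_smul' := fun c y => by
        refine eq_of_repr_eq b fun n => ?_
        simp [mul_left_comm] }
  refine ⟨R.mkContinuous C fun y => ?_, fun y n => by simp [R]⟩
  have h1 : ‖R y‖ = ‖(⟨_, hm y⟩ : lp (fun _ => ℂ) 2)‖ := b.repr.symm.norm_map _
  have h2 : ‖(⟨_, hm y⟩ : lp (fun _ => ℂ) 2)‖ ≤ ‖(C : ℂ) • b.repr y‖ :=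
    lp.norm_mono two_ne_zero (hb y)
  rw [h1]
  refine h2.trans (le_of_eq ?_)
  rw [norm_smul, b.repr.norm_map, Complex.norm_real, Real.norm_of_nonneg hC]

/-- The resolvent is the diagonal operator with entries `(a n - z)⁻¹`, bounded by `c⁻¹`. Its range
lies in the domain because the graph is maximal: membership is only a condition on coordinates. -/
theorem mem_resolventSet_of_bounded_below (hg : T.graph = diagonalGraph b a) {z : ℂ} {c : ℝ}
    (hc : 0 < c) (hz : ∀ n, c ≤ ‖(a n : ℂ) - z‖) : z ∈ resolventSet T := by
  have hne : ∀ n, (a n : ℂ) - z ≠ 0 := fun n => norm_pos_iff.1 (hc.trans_le (hz n))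
  obtain ⟨R, hR⟩ := exists_diagonal_clm b (fun n => ((a n : ℂ) - z)⁻¹) (inv_nonneg.2 hc.le)
    (fun n => by rw [norm_inv]; exact inv_anti₀ hc (hz n))
  refine ⟨R, fun y => ?_, fun x => ?_⟩
  · have hm : (R y, y + z • R y) ∈ T.graph := by
      rw [hg]
      intro n
      have := hne n
      simp only [map_add, map_smul, lp.coeFn_add, lp.coeFn_smul, Pi.add_apply, Pi.smul_apply,
        smul_eq_mul, hR]
      field_simp
      ring
    have hdom := LinearPMap.mem_domain_of_mem_graph hm
    refine ⟨hdom, ?_⟩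
    have := T.mem_graph_snd_inj (T.mem_graph ⟨R y, hdom⟩) hm rfl
    rw [this]
    simp
  · refine eq_of_repr_eq b fun n => ?_
    have h1 : b.repr (T x) n = (a n : ℂ) * b.repr (x : E) n := by
      have := T.mem_graph x
      rw [hg] at this
      exact this n
    have := hne n
    rw [hR]
    simp only [map_sub, map_smul, lp.coeFn_sub, lp.coeFn_smul, Pi.sub_apply, Pi.smul_apply,
      smul_eq_mul, h1]
    field_simp

theorem mem_eigenspace_iff {z : ℂ} {x : E} : x ∈ eigenspace T z ↔ (x, z • x) ∈ T.graph := by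
  rw [LinearPMap.mem_graph_iff]
  constructor
  · rintro ⟨h, h'⟩
    exact ⟨⟨x, h⟩, rfl, h'⟩
  · rintro ⟨y, rfl, h'⟩
    exact ⟨y.2, h'⟩

theorem notMem_resolventSet_of_eigenvector {z : ℂ} {x : E} (hx : x ∈ eigenspace T z) (h0 : x ≠ 0) :
    z ∉ resolventSet T := by
  rintro ⟨R, -, h⟩
  obtain ⟨hd, hz⟩ := hx
  have := h ⟨x, hd⟩
  rw [hz] at this
  simp at this
  exact h0 this.symm

theorem eigenspace_eq_span (hg : T.graph = diagonalGraph b a) (ha : Function.Injective a) (n : ℕ) :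
    eigenspace T (a n : ℂ) = Submodule.span ℂ {b n} := by
  ext x
  rw [mem_eigenspace_iff, hg, Submodule.mem_span_singleton]
  constructor
  · intro h
    refine ⟨b.repr x n, eq_of_repr_eq b fun m => ?_⟩
    rcases eq_or_ne n m with rfl | hne
    · simp [repr_self_self]
    · have h1 := h m
      simp only [map_smul, lp.coeFn_smul, Pi.smul_apply, smul_eq_mul] at h1 ⊢
      rw [repr_self_of_ne b hne, mul_zero]
      have h2 : ((a n : ℂ) - a m) * b.repr x m = 0 := by rw [sub_mul, h1, sub_self]
      rcases mul_eq_zero.1 h2 with h3 | h3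
      · rw [sub_eq_zero, Complex.ofReal_inj] at h3
        exact absurd (ha h3) hne
      · exact h3.symm
  · rintro ⟨c, rfl⟩
    have := Submodule.smul_mem _ c (basis_mem_diagonalGraph b a n)
    rwa [Prod.smul_mk, smul_comm] at this

/-- The eigenvalues are uniformly separated. -/
theorem spectrum_eq_range (hg : T.graph = diagonalGraph b a) {c : ℝ} (hc : 0 < c)
    (hsep : ∀ n m, n ≠ m → c ≤ |a n - a m|) :
    spectrum T = Set.range fun n => (a n : ℂ) := by
  ext z
  constructor
  · intro hz
    by_contra hne
    refine hz ?_
    have hne' : ∀ n, 0 < ‖(a n : ℂ) - z‖ := fun n =>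
      norm_pos_iff.2 fun h => hne ⟨n, sub_eq_zero.1 h⟩
    -- If `a n` is within `c / 2` of `z`, every other entry is farther than `c / 2`, so `‖a n - z‖`
    -- is itself a lower bound; otherwise `c / 2` is one.
    by_cases h : ∃ n, ‖(a n : ℂ) - z‖ < c / 2
    · obtain ⟨n, hn⟩ := h
      refine mem_resolventSet_of_bounded_below hg (hne' n) fun m => ?_
      rcases eq_or_ne n m with rfl | hnm
      · exact le_rfl
      · have h1 : c ≤ ‖((a n : ℂ) - z) - ((a m : ℂ) - z)‖ := by
          rw [sub_sub_sub_cancel_right, ← Complex.ofReal_sub, Complex.norm_real]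
          exact hsep n m hnm
        have h2 := norm_sub_le ((a n : ℂ) - z) ((a m : ℂ) - z)
        linarith
    · push Not at h
      exact mem_resolventSet_of_bounded_below hg (half_pos hc) h
  · rintro ⟨n, rfl⟩
    refine notMem_resolventSet_of_eigenvector (x := b n) ?_ (b.orthonormal.ne_zero n)
    rw [mem_eigenspace_iff, hg]
    exact basis_mem_diagonalGraph b a n

theorem hasPurelyDiscreteSpectrum_of_diagonal (hg : T.graph = diagonalGraph b a) {c : ℝ}
    (hc : 0 < c) (hsep : ∀ n m, n ≠ m → c ≤ |a n - a m|) : HasPurelyDiscreteSpectrum T := by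
  have ha : Function.Injective a := fun n m h => by
    by_contra hne
    have := hsep n m hne
    rw [h, sub_self, abs_zero] at this
    linarith
  intro z hz
  rw [spectrum_eq_range hg hc hsep] at hz
  obtain ⟨n, rfl⟩ := hz
  refine ⟨⟨c, hc, fun w hw hwz => ?_⟩, ?_, ?_⟩
  · rw [spectrum_eq_range hg hc hsep] at hw
    obtain ⟨m, rfl⟩ := hw
    have : m ≠ n := fun h => hwz (by rw [h])
    rw [dist_eq_norm, ← Complex.ofReal_sub, Complex.norm_real]
    exact hsep m n this
  · simp only [eigenspace_eq_span hg ha, ne_eq, Submodule.span_singleton_eq_bot]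
    exact b.orthonormal.ne_zero n
  · change FiniteDimensional ℂ (eigenspace T (a n : ℂ))
    rw [eigenspace_eq_span hg ha]
    infer_instance

end

end UnboundedOperator

/-! ### Division by the variable and the Dunkl operator on Schwartz functions -/

open MeasureTheory Set Filter Topology
open scoped SchwartzMap ContDiff

namespace SchwartzMap

theorem exists_bound (φ : 𝓢(ℝ, ℂ)) (k : ℕ) : ∃ C : ℝ, ∀ x, |x| ^ k * ‖φ x‖ ≤ C :=
  ⟨_, fun x => by simpa using norm_pow_mul_le_seminorm ℂ φ k x⟩

/-- The integrals `∫ s in 0..1, s ^ n * φ⁽ⁿ⁺¹⁾ (s * x)`, the iterated derivatives of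
`φ x / x` if `φ 0 = 0`. -/
noncomputable def hadamardIntegral (φ : 𝓢(ℝ, ℂ)) (n : ℕ) (x : ℝ) : ℂ :=
  ∫ s in (0 : ℝ)..1, (s : ℂ) ^ n * ((derivCLM ℂ ℂ)^[n + 1] φ) (s * x)

theorem hasDerivAt_iterate_derivCLM (φ : 𝓢(ℝ, ℂ)) (n : ℕ) (x : ℝ) :
    HasDerivAt ((derivCLM ℂ ℂ)^[n] φ) (((derivCLM ℂ ℂ)^[n + 1] φ) x) x := by
  rw [Function.iterate_succ_apply', derivCLM_apply]
  exact SchwartzMap.hasDerivAt _ x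

theorem norm_hadamardIntegral_le (φ : 𝓢(ℝ, ℂ)) (n : ℕ) :
    ∃ C : ℝ, ∀ x, ‖hadamardIntegral φ n x‖ ≤ C := by
  obtain ⟨C, hC⟩ := exists_bound ((derivCLM ℂ ℂ)^[n + 1] φ) 0
  refine ⟨C, fun x => ?_⟩
  have h := intervalIntegral.norm_integral_le_of_norm_le_const (a := (0 : ℝ)) (b := 1) (C := C)
    (f := fun s : ℝ => (s : ℂ) ^ n * ((derivCLM ℂ ℂ)^[n + 1] φ) (s * x)) ?_
  · rwa [sub_zero, abs_one, mul_one] at h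
  · intro s hs
    rw [uIoc_of_le zero_le_one] at hs
    have h1 := hC (s * x)
    rw [pow_zero, one_mul] at h1
    rw [norm_mul, norm_pow, Complex.norm_real, Real.norm_of_nonneg hs.1.le]
    exact (mul_le_of_le_one_left (norm_nonneg _) (pow_le_one₀ hs.1.le hs.2)).trans h1

/-- Differentiation under the integral sign; a bound for the derivative of order `n + 2` of `φ`
dominates, as `0 < s ≤ 1`. -/
theorem hasDerivAt_hadamardIntegral (φ : 𝓢(ℝ, ℂ)) (n : ℕ) (x : ℝ) :
    HasDerivAt (hadamardIntegral φ n) (hadamardIntegral φ (n + 1) x) x := by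
  obtain ⟨C, hC⟩ := exists_bound ((derivCLM ℂ ℂ)^[n + 2] φ) 0
  have hcont : ∀ (m : ℕ) (ψ : 𝓢(ℝ, ℂ)) (y : ℝ),
      Continuous fun s : ℝ => (s : ℂ) ^ m * ψ (s * y) := fun m ψ y =>
    (Complex.continuous_ofReal.pow m).mul (ψ.continuous.comp (continuous_id.mul continuous_const))
  refine (intervalIntegral.hasDerivAt_integral_of_dominated_loc_of_deriv_le (bound := fun _ => C)
    (F' := fun y s => (s : ℂ) ^ (n + 1) * ((derivCLM ℂ ℂ)^[n + 2] φ) (s * y)) (s := univ)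
    univ_mem (Eventually.of_forall fun y => (hcont _ _ y).aestronglyMeasurable)
    ((hcont _ _ x).intervalIntegrable _ _) (hcont _ _ x).aestronglyMeasurable
    (Eventually.of_forall fun s hs y _ => ?_) (by simp)
    (Eventually.of_forall fun s _ y _ => ?_)).2
  · rw [uIoc_of_le zero_le_one] at hs
    have h1 := hC (s * y)
    rw [pow_zero, one_mul] at h1
    rw [norm_mul, norm_pow, Complex.norm_real, Real.norm_of_nonneg hs.1.le]
    exact (mul_le_of_le_one_left (norm_nonneg _) (pow_le_one₀ hs.1.le hs.2)).trans h1
  · have h1 := (hasDerivAt_iterate_derivCLM φ (n + 1) (s * y)).scomp y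
      ((hasDerivAt_id y).const_mul s)
    have h2 := h1.const_mul ((s : ℂ) ^ n)
    refine h2.congr_deriv ?_
    simp [pow_succ, mul_assoc]

/-- The fundamental theorem of calculus for `s ↦ φ (s x)` on `[0, 1]`. -/
theorem mul_hadamardIntegral_zero (φ : 𝓢(ℝ, ℂ)) (h0 : φ 0 = 0) (x : ℝ) :
    (x : ℂ) * hadamardIntegral φ 0 x = φ x := by
  have h : ∀ s ∈ uIcc (0 : ℝ) 1,
      HasDerivAt (fun s : ℝ => φ (s * x)) ((x : ℂ) * ((derivCLM ℂ ℂ)^[1] φ) (s * x)) s := by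
    intro s _
    have h1 := (hasDerivAt_iterate_derivCLM φ 0 (s * x)).scomp s
      ((hasDerivAt_id s).mul_const x)
    refine h1.congr_deriv ?_
    simp
  have hint : IntervalIntegrable
      (fun s : ℝ => (x : ℂ) * ((derivCLM ℂ ℂ)^[1] φ) (s * x)) volume 0 1 :=
    (continuous_const.mul ((SchwartzMap.continuous _).comp
      (continuous_id.mul continuous_const))).intervalIntegrable _ _
  have h2 := intervalIntegral.integral_eq_sub_of_hasDerivAt h hint
  simp only [intervalIntegral.integral_const_mul, one_mul, zero_mul, h0, sub_zero] at h2
  simpa [hadamardIntegral] using h2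

/-- Leibniz' rule for the derivative of order `n + 1` of `φ = x g`, obtained by differentiating the
previous relation. It trades a factor `x` for a derivative of lower order. -/
theorem mul_hadamardIntegral_succ (φ : 𝓢(ℝ, ℂ)) (h0 : φ 0 = 0) (n : ℕ) (x : ℝ) :
    (x : ℂ) * hadamardIntegral φ (n + 1) x + (n + 1) * hadamardIntegral φ n x =
      ((derivCLM ℂ ℂ)^[n + 1] φ) x := by
  have hx : ∀ x : ℝ, HasDerivAt (fun y : ℝ => (y : ℂ)) 1 x := fun x =>
    Complex.ofRealCLM.hasDerivAt
  have key : ∀ n : ℕ, ∀ x : ℝ, HasDerivAt (fun y : ℝ => (y : ℂ) * hadamardIntegral φ n y)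
      (hadamardIntegral φ n x + x * hadamardIntegral φ (n + 1) x) x := fun n x =>
    ((hx x).mul (hasDerivAt_hadamardIntegral φ n x)).congr_deriv (by rw [one_mul])
  induction n generalizing x with
  | zero =>
    have h1 := hasDerivAt_iterate_derivCLM φ 0 x
    have h2 := key 0 x
    have h3 : (fun y : ℝ => (y : ℂ) * hadamardIntegral φ 0 y) = φ :=
      funext (mul_hadamardIntegral_zero φ h0)
    rw [h3] at h2
    have := h1.unique h2
    rw [this]
    push_cast
    ring
  | succ n ih =>
    have h1 := hasDerivAt_iterate_derivCLM φ (n + 1) x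
    have h2 := (key (n + 1) x).add ((hasDerivAt_hadamardIntegral φ n x).const_mul ((n : ℂ) + 1))
    have h3 : ((fun y : ℝ => (y : ℂ) * hadamardIntegral φ (n + 1) y) +
        fun y => ((n : ℂ) + 1) * hadamardIntegral φ n y) = ((derivCLM ℂ ℂ)^[n + 1] φ) :=
      funext fun y => ih y
    rw [h3] at h2
    have := h1.unique h2
    rw [this]
    push_cast
    ring

/-- Induction on the power: `x g⁽ⁿ⁺¹⁾ = φ⁽ⁿ⁺¹⁾ - (n + 1) g⁽ⁿ⁾` lowers both `k` and `n`, and `k = 0`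
is boundedness. -/
theorem exists_bound_hadamardIntegral (φ : 𝓢(ℝ, ℂ)) (h0 : φ 0 = 0) (n k : ℕ) :
    ∃ C : ℝ, ∀ x, |x| ^ k * ‖hadamardIntegral φ n x‖ ≤ C := by
  induction k generalizing n with
  | zero => simpa using norm_hadamardIntegral_le φ n
  | succ k ih =>
    cases n with
    | zero =>
      obtain ⟨C, hC⟩ := exists_bound φ k
      refine ⟨C, fun x => ?_⟩
      have h := hC x
      rwa [← mul_hadamardIntegral_zero φ h0 x, norm_mul, Complex.norm_real, Real.norm_eq_abs,
        ← mul_assoc, ← pow_succ] at h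
    | succ n =>
      obtain ⟨C, hC⟩ := exists_bound ((derivCLM ℂ ℂ)^[n + 1] φ) k
      obtain ⟨C', hC'⟩ := ih n
      refine ⟨C + (n + 1) * C', fun x => ?_⟩
      have h1 : (x : ℂ) * hadamardIntegral φ (n + 1) x =
          ((derivCLM ℂ ℂ)^[n + 1] φ) x - (n + 1) * hadamardIntegral φ n x := by
        rw [← mul_hadamardIntegral_succ φ h0 n x]
        ring
      have h2 : |x| ^ (k + 1) * ‖hadamardIntegral φ (n + 1) x‖ =
          |x| ^ k * ‖(x : ℂ) * hadamardIntegral φ (n + 1) x‖ := by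
        rw [norm_mul, Complex.norm_real, Real.norm_eq_abs, ← mul_assoc, pow_succ]
      have h3 : ‖((n : ℂ) + 1) * hadamardIntegral φ n x‖ =
          ((n : ℝ) + 1) * ‖hadamardIntegral φ n x‖ := by
        rw [norm_mul]
        congr 1
        exact_mod_cast Complex.norm_natCast (n + 1)
      rw [h2, h1]
      calc |x| ^ k * ‖((derivCLM ℂ ℂ)^[n + 1] φ) x - (n + 1) * hadamardIntegral φ n x‖
          ≤ |x| ^ k * (‖((derivCLM ℂ ℂ)^[n + 1] φ) x‖ +
            ((n : ℝ) + 1) * ‖hadamardIntegral φ n x‖) := by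
            rw [← h3]
            exact mul_le_mul_of_nonneg_left (norm_sub_le _ _) (by positivity)
        _ = |x| ^ k * ‖((derivCLM ℂ ℂ)^[n + 1] φ) x‖ +
            ((n : ℝ) + 1) * (|x| ^ k * ‖hadamardIntegral φ n x‖) := by ring
        _ ≤ C + (n + 1) * C' :=
            add_le_add (hC x) (mul_le_mul_of_nonneg_left (hC' x) (by positivity))

theorem iteratedDeriv_hadamardIntegral (φ : 𝓢(ℝ, ℂ)) (n : ℕ) :
    iteratedDeriv n (hadamardIntegral φ 0) = hadamardIntegral φ n := by
  induction n with
  | zero => simp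
  | succ n ih =>
    rw [iteratedDeriv_succ, ih]
    exact funext fun x => (hasDerivAt_hadamardIntegral φ n x).deriv

/-- A Schwartz function on the line that vanishes at the origin is divisible by the variable. -/
theorem exists_eq_mul_of_apply_zero (φ : 𝓢(ℝ, ℂ)) (h0 : φ 0 = 0) :
    ∃ ψ : 𝓢(ℝ, ℂ), ∀ x : ℝ, (x : ℂ) * ψ x = φ x := by
  refine ⟨⟨hadamardIntegral φ 0, ?_, fun k n => ?_⟩, mul_hadamardIntegral_zero φ h0⟩
  · refine contDiff_of_differentiable_iteratedDeriv fun m _ => ?_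
    rw [iteratedDeriv_hadamardIntegral]
    exact fun x => (hasDerivAt_hadamardIntegral φ m x).differentiableAt
  · obtain ⟨C, hC⟩ := exists_bound_hadamardIntegral φ h0 n k
    refine ⟨C, fun x => ?_⟩
    rw [norm_iteratedFDeriv_eq_norm_iteratedDeriv, iteratedDeriv_hadamardIntegral]
    exact hC x

/-- The reflected function `x ↦ φ (-x)`. -/
noncomputable def reflect : 𝓢(ℝ, ℂ) →L[ℂ] 𝓢(ℝ, ℂ) :=
  compCLMOfContinuousLinearEquiv ℂ (ContinuousLinearEquiv.neg ℝ)

@[simp]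
theorem reflect_apply (φ : 𝓢(ℝ, ℂ)) (x : ℝ) : reflect φ x = φ (-x) := rfl

theorem exists_oddQuotient (φ : 𝓢(ℝ, ℂ)) :
    ∃ ψ : 𝓢(ℝ, ℂ), ∀ x : ℝ, (x : ℂ) * ψ x = (φ x - φ (-x)) / 2 := by
  obtain ⟨ψ, hψ⟩ := exists_eq_mul_of_apply_zero ((1 / 2 : ℂ) • (φ - reflect φ)) (by simp)
  refine ⟨ψ, fun x => ?_⟩
  rw [hψ x]
  simp
  ring

/-- The function `(φ x - φ (-x)) / (2 x)`. -/
noncomputable def oddQuotient (φ : 𝓢(ℝ, ℂ)) : 𝓢(ℝ, ℂ) := (exists_oddQuotient φ).choose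

theorem mul_oddQuotient (φ : 𝓢(ℝ, ℂ)) (x : ℝ) :
    (x : ℂ) * oddQuotient φ x = (φ x - φ (-x)) / 2 := (exists_oddQuotient φ).choose_spec x

/-- The Dunkl operator `φ' + (μ / x) (φ x - φ (-x))` on the line. -/
noncomputable def dunkl (μ : ℝ) (φ : 𝓢(ℝ, ℂ)) : 𝓢(ℝ, ℂ) :=
  derivCLM ℂ ℂ φ + (2 * μ : ℂ) • oddQuotient φ

theorem dunkl_apply (μ : ℝ) (φ : 𝓢(ℝ, ℂ)) {x : ℝ} (hx : x ≠ 0) :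
    dunkl μ φ x = deriv φ x + μ * (φ x - φ (-x)) / x := by
  have hx' : (x : ℂ) ≠ 0 := Complex.ofReal_ne_zero.2 hx
  have h : oddQuotient φ x = (φ x - φ (-x)) / 2 / x := by
    rw [← mul_oddQuotient]
    field_simp
  simp only [dunkl, add_apply, smul_apply, derivCLM_apply, h, smul_eq_mul]
  field_simp

theorem hasTemperateGrowth_ofReal' : Function.HasTemperateGrowth fun x : ℝ => (x : ℂ) :=
  Complex.ofRealCLM.hasTemperateGrowth

/-- The multiplication by the variable. -/
noncomputable def mulX : 𝓢(ℝ, ℂ) →L[ℂ] 𝓢(ℝ, ℂ) := smulLeftCLM ℂ fun x : ℝ => (x : ℂ)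

@[simp]
theorem mulX_apply (φ : 𝓢(ℝ, ℂ)) (x : ℝ) : mulX φ x = x * φ x := by
  rw [mulX, smulLeftCLM_apply_apply hasTemperateGrowth_ofReal', smul_eq_mul]

/-- The explicit formula for `dunkl` divides by `x`; by continuity, identities between Schwartz
functions need checking only off the origin. -/
theorem ext_off_zero {φ ψ : 𝓢(ℝ, ℂ)} (h : ∀ x : ℝ, x ≠ 0 → φ x = ψ x) : φ = ψ := by
  have h1 : (φ : ℝ → ℂ) = ψ :=
    Continuous.ext_on (dense_compl_singleton (0 : ℝ)) φ.continuous ψ.continuous fun x hx => h x hx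
  exact DFunLike.coe_injective h1

theorem dunkl_add (μ : ℝ) (φ ψ : 𝓢(ℝ, ℂ)) : dunkl μ (φ + ψ) = dunkl μ φ + dunkl μ ψ := by
  refine ext_off_zero fun x hx => ?_
  have h : deriv (⇑(φ + ψ)) x = deriv φ x + deriv ψ x :=
    ((SchwartzMap.hasDerivAt φ x).add (SchwartzMap.hasDerivAt ψ x)).deriv
  simp only [add_apply, dunkl_apply μ _ hx, h]
  ring

theorem dunkl_smul (μ : ℝ) (c : ℂ) (φ : 𝓢(ℝ, ℂ)) : dunkl μ (c • φ) = c • dunkl μ φ := by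
  refine ext_off_zero fun x hx => ?_
  have h : deriv (⇑(c • φ)) x = c * deriv φ x :=
    ((SchwartzMap.hasDerivAt φ x).const_smul c).deriv
  simp only [smul_apply, dunkl_apply μ _ hx, h, smul_eq_mul]
  ring

theorem dunkl_sub (μ : ℝ) (φ ψ : 𝓢(ℝ, ℂ)) : dunkl μ (φ - ψ) = dunkl μ φ - dunkl μ ψ := by
  have h : φ - ψ = φ + (-1 : ℂ) • ψ := by simp [sub_eq_add_neg]
  rw [h, dunkl_add, dunkl_smul]
  simp [sub_eq_add_neg]

theorem deriv_reflect (φ : 𝓢(ℝ, ℂ)) (x : ℝ) : deriv (reflect φ) x = -deriv φ (-x) := by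
  have h : (reflect φ : ℝ → ℂ) = fun y => φ (-y) := rfl
  rw [h]
  exact deriv_comp_neg φ x

theorem dunkl_reflect (μ : ℝ) (φ : 𝓢(ℝ, ℂ)) : dunkl μ (reflect φ) = -reflect (dunkl μ φ) := by
  refine ext_off_zero fun x hx => ?_
  rw [dunkl_apply μ _ hx, deriv_reflect, neg_apply,
    reflect_apply (dunkl μ φ), dunkl_apply μ _ (neg_ne_zero.2 hx)]
  simp only [reflect_apply, neg_neg, Complex.ofReal_neg, div_neg]
  ring

theorem reflect_mulX (φ : 𝓢(ℝ, ℂ)) : reflect (mulX φ) = -mulX (reflect φ) := by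
  ext x
  simp

/-- The deformed Heisenberg relation `[D, x] = 1 + 2μR`. The reflection term makes the ladder
constants depend on parity. -/
theorem dunkl_mulX (μ : ℝ) (φ : 𝓢(ℝ, ℂ)) :
    dunkl μ (mulX φ) = mulX (dunkl μ φ) + φ + (2 * μ : ℂ) • reflect φ := by
  refine ext_off_zero fun x hx => ?_
  have hx' : (x : ℂ) ≠ 0 := Complex.ofReal_ne_zero.2 hx
  have h : deriv (mulX φ) x = φ x + x * deriv φ x := by
    have h1 : (mulX φ : ℝ → ℂ) = fun y : ℝ => (y : ℂ) * φ y := funext (mulX_apply φ)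
    rw [h1]
    have h2 : HasDerivAt (fun y : ℝ => (y : ℂ)) 1 x := Complex.ofRealCLM.hasDerivAt
    rw [← one_mul (φ x)]
    exact (h2.mul (SchwartzMap.hasDerivAt φ x)).deriv
  simp only [add_apply, smul_apply, mulX_apply, dunkl_apply μ _ hx, h, reflect_apply, smul_eq_mul,
    Complex.ofReal_neg]
  field_simp
  ring

end SchwartzMap

/-! ### The weighted measure on the line -/

/-- The measure `|t| ^ (2 μ) dt` on the line. -/
noncomputable def weightMeasure (μ : ℝ) : Measure ℝ :=
  (volume : Measure ℝ).withDensity fun t => ENNReal.ofReal (|t| ^ (2 * μ))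

theorem measurable_weight (μ : ℝ) : Measurable fun t : ℝ => ENNReal.ofReal (|t| ^ (2 * μ)) := by
  fun_prop

theorem weightMeasure_absolutelyContinuous (μ : ℝ) : weightMeasure μ ≪ volume :=
  withDensity_absolutelyContinuous _ _

theorem ae_weightMeasure_ne_zero (μ : ℝ) : ∀ᵐ t ∂weightMeasure μ, t ≠ 0 :=
  (weightMeasure_absolutelyContinuous μ).ae_le (Measure.ae_ne volume 0)

theorem integral_weightMeasure (μ : ℝ) (g : ℝ → ℂ) :
    ∫ t, g t ∂weightMeasure μ = ∫ t, |t| ^ (2 * μ) • g t := by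
  rw [weightMeasure, integral_withDensity_eq_integral_toReal_smul (measurable_weight μ)
    (Eventually.of_forall fun _ => ENNReal.ofReal_lt_top)]
  refine integral_congr_ae (Eventually.of_forall fun t => ?_)
  simp only
  rw [ENNReal.toReal_ofReal (by positivity)]

theorem integrable_weightMeasure_iff {E : Type*} [NormedAddCommGroup E] [NormedSpace ℝ E]
    (μ : ℝ) (g : ℝ → E) :
    Integrable g (weightMeasure μ) ↔ Integrable fun t => |t| ^ (2 * μ) • g t := by
  rw [weightMeasure, integrable_withDensity_iff_integrable_smul' (measurable_weight μ)
    (Eventually.of_forall fun _ => ENNReal.ofReal_lt_top)]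
  refine integrable_congr (Eventually.of_forall fun t => ?_)
  simp only
  rw [ENNReal.toReal_ofReal (by positivity)]

/-- This makes every Schwartz function integrable and square integrable for the weight. In the
exponent, `⌈2 * μ⌉₊` absorbs the weight and `2` leaves an integrable power. -/
theorem hasTemperateGrowth_weightMeasure {μ : ℝ} (hμ : 0 < μ) :
    (weightMeasure μ).HasTemperateGrowth := by
  refine ⟨⌈2 * μ⌉₊ + 2, ?_⟩
  rw [integrable_weightMeasure_iff]
  have h : Integrable fun t : ℝ => (1 + ‖t‖) ^ (-(2 : ℝ)) :=
    integrable_one_add_norm (by simp)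
  refine h.mono (Measurable.aestronglyMeasurable (by fun_prop)) (Eventually.of_forall fun t => ?_)
  have h1 : (0 : ℝ) < 1 + ‖t‖ := by positivity
  calc ‖|t| ^ (2 * μ) • (1 + ‖t‖) ^ (-((⌈2 * μ⌉₊ + 2 : ℕ) : ℝ))‖
      = |t| ^ (2 * μ) * (1 + ‖t‖) ^ (-((⌈2 * μ⌉₊ + 2 : ℕ) : ℝ)) :=
        Real.norm_of_nonneg (by positivity)
    _ ≤ (1 + ‖t‖) ^ (2 * μ) * (1 + ‖t‖) ^ (-((⌈2 * μ⌉₊ + 2 : ℕ) : ℝ)) := by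
        refine mul_le_mul_of_nonneg_right ?_ (by positivity)
        exact Real.rpow_le_rpow (abs_nonneg _) (by rw [Real.norm_eq_abs]; linarith) (by positivity)
    _ = (1 + ‖t‖) ^ (2 * μ + -((⌈2 * μ⌉₊ + 2 : ℕ) : ℝ)) := (Real.rpow_add h1 _ _).symm
    _ ≤ (1 + ‖t‖) ^ (-(2 : ℝ)) := by
        refine Real.rpow_le_rpow_of_exponent_le (by linarith [norm_nonneg t]) ?_
        have := Nat.le_ceil (2 * μ)
        push_cast
        linarith
    _ ≤ ‖(1 + ‖t‖) ^ (-(2 : ℝ))‖ := Real.le_norm_self _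

/-- Folding a weighted integral over the line to the half-line. -/
theorem integral_weightMeasure_eq_Ioi (μ : ℝ) {g : ℝ → ℂ} (hg : Integrable g (weightMeasure μ)) :
    ∫ t, g t ∂weightMeasure μ = ∫ t in Ioi (0 : ℝ), t ^ (2 * μ) • (g t + g (-t)) := by
  rw [integrable_weightMeasure_iff] at hg
  rw [integral_weightMeasure, ← intervalIntegral.integral_Iic_add_Ioi (b := 0) hg.integrableOn
    hg.integrableOn, ← neg_zero, ← integral_comp_neg_Ioi, neg_zero]
  have h1 : IntegrableOn (fun x => |-x| ^ (2 * μ) • g (-x)) (Ioi 0) := (hg.comp_neg).integrableOn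
  rw [← integral_add h1 hg.integrableOn]
  refine setIntegral_congr_fun measurableSet_Ioi fun t ht => ?_
  rw [abs_neg, abs_of_pos ht, smul_add, add_comm]

theorem integrableOn_Ioi_of_integrable_weightMeasure (μ : ℝ) {g : ℝ → ℂ}
    (hg : Integrable g (weightMeasure μ)) :
    IntegrableOn (fun t => t ^ (2 * μ) • (g t + g (-t))) (Ioi 0) := by
  rw [integrable_weightMeasure_iff] at hg
  refine (hg.integrableOn.add (hg.comp_neg.integrableOn (s := Ioi 0))).congr_fun ?_
    measurableSet_Ioi
  intro t ht
  simp only [Pi.add_apply]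
  rw [abs_neg, abs_of_pos ht, smul_add]

/-! ### The weighted pairing and antisymmetry of the Dunkl operator -/

namespace SchwartzMap

/-- The product of two Schwartz functions. -/
noncomputable def product (φ ψ : 𝓢(ℝ, ℂ)) : 𝓢(ℝ, ℂ) := pairing (ContinuousLinearMap.mul ℂ ℂ) φ ψ

@[simp]
theorem product_apply (φ ψ : 𝓢(ℝ, ℂ)) (x : ℝ) : product φ ψ x = φ x * ψ x := rfl

theorem integrable_weight (φ : 𝓢(ℝ, ℂ)) {μ : ℝ} (hμ : 0 < μ) : Integrable φ (weightMeasure μ) :=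
  haveI := hasTemperateGrowth_weightMeasure hμ
  φ.integrable

theorem memLp_weight (φ : 𝓢(ℝ, ℂ)) {μ : ℝ} (hμ : 0 < μ) : MemLp φ 2 (weightMeasure μ) :=
  haveI := hasTemperateGrowth_weightMeasure hμ
  φ.memLp 2 _

/-- The weighted pairing `∫ φ ψ |x| ^ (2 μ) dx`. -/
noncomputable def weightedPairing (μ : ℝ) (φ ψ : 𝓢(ℝ, ℂ)) : ℂ :=
  ∫ x, φ x * ψ x ∂weightMeasure μ

theorem weightedPairing_add_left {μ : ℝ} (hμ : 0 < μ) (φ₁ φ₂ ψ : 𝓢(ℝ, ℂ)) :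
    weightedPairing μ (φ₁ + φ₂) ψ = weightedPairing μ φ₁ ψ + weightedPairing μ φ₂ ψ := by
  simp only [weightedPairing]
  refine Eq.trans ?_
    (integral_add ((product φ₁ ψ).integrable_weight hμ) ((product φ₂ ψ).integrable_weight hμ))
  simp [add_mul]

theorem weightedPairing_smul_left (μ : ℝ) (c : ℂ) (φ ψ : 𝓢(ℝ, ℂ)) :
    weightedPairing μ (c • φ) ψ = c * weightedPairing μ φ ψ := by
  simp only [weightedPairing]
  rw [← integral_const_mul]
  simp [mul_assoc]

theorem weightedPairing_comm (μ : ℝ) (φ ψ : 𝓢(ℝ, ℂ)) :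
    weightedPairing μ φ ψ = weightedPairing μ ψ φ := by
  simp only [weightedPairing, mul_comm]

theorem weightedPairing_sub_left {μ : ℝ} (hμ : 0 < μ) (φ₁ φ₂ ψ : 𝓢(ℝ, ℂ)) :
    weightedPairing μ (φ₁ - φ₂) ψ = weightedPairing μ φ₁ ψ - weightedPairing μ φ₂ ψ := by
  have h : φ₁ - φ₂ = φ₁ + (-1 : ℂ) • φ₂ := by simp [sub_eq_add_neg]
  rw [h, weightedPairing_add_left hμ, weightedPairing_smul_left]
  ring

theorem weightedPairing_mulX (μ : ℝ) (φ ψ : 𝓢(ℝ, ℂ)) :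
    weightedPairing μ (mulX φ) ψ = weightedPairing μ φ (mulX ψ) := by
  simp only [weightedPairing, mulX_apply]
  congr 1
  ext x
  ring

/-- The Dunkl operator is antisymmetric for the weight `|x| ^ (2 μ)`. -/
theorem weightedPairing_dunkl {μ : ℝ} (hμ : 0 < μ) (φ ψ : 𝓢(ℝ, ℂ)) :
    weightedPairing μ (dunkl μ φ) ψ = -weightedPairing μ φ (dunkl μ ψ) := by
  set G : 𝓢(ℝ, ℂ) := product (dunkl μ φ) ψ + product φ (dunkl μ ψ) with hG
  -- After folding to the half-line, `x^(2μ) Q` is a primitive of `x^(2μ) (G x + G (-x))`: the mixed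
  -- terms `φ(x) ψ(-x)` cancel between `x` and `-x`. It vanishes at `0` since `μ > 0`, and at
  -- infinity by decay.
  set Q : 𝓢(ℝ, ℂ) := product φ ψ - reflect (product φ ψ) with hQ
  have hsum : weightedPairing μ (dunkl μ φ) ψ + weightedPairing μ φ (dunkl μ ψ) =
      ∫ x, G x ∂weightMeasure μ := by
    simp only [weightedPairing, hG]
    refine (integral_add ((product (dunkl μ φ) ψ).integrable_weight hμ)
      ((product φ (dunkl μ ψ)).integrable_weight hμ)).symm.trans ?_
    simp
  have hP : ∀ x, deriv (product φ ψ) x = deriv φ x * ψ x + φ x * deriv ψ x := fun x =>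
    ((SchwartzMap.hasDerivAt φ x).mul (SchwartzMap.hasDerivAt ψ x)).deriv
  have hQ' : ∀ x, deriv Q x = deriv (product φ ψ) x + deriv (product φ ψ) (-x) := fun x => by
    have h := ((SchwartzMap.hasDerivAt (product φ ψ) x).sub
      (SchwartzMap.hasDerivAt (reflect (product φ ψ)) x)).deriv
    rw [deriv_reflect, sub_neg_eq_add] at h
    exact h
  have hder : ∀ x ∈ Ioi (0 : ℝ), HasDerivAt (fun x : ℝ => x ^ (2 * μ) • Q x)
      (x ^ (2 * μ) • (G x + G (-x))) x := by
    intro x hx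
    have hx0 : x ≠ 0 := ne_of_gt hx
    have hx' : (x : ℂ) ≠ 0 := Complex.ofReal_ne_zero.2 hx0
    have h1 := (Real.hasDerivAt_rpow_const (p := 2 * μ) (Or.inl hx0)).smul
      (SchwartzMap.hasDerivAt Q x)
    refine h1.congr_deriv ?_
    rw [Real.rpow_sub_one hx0, hQ', hP, hP]
    simp only [hG, hQ, add_apply, sub_apply, product_apply, reflect_apply, dunkl_apply μ _ hx0,
      dunkl_apply μ _ (neg_ne_zero.2 hx0), Complex.real_smul, neg_neg, Complex.ofReal_neg]
    push_cast
    field_simp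
    ring
  have hint : IntegrableOn (fun x => x ^ (2 * μ) • (G x + G (-x))) (Ioi 0) :=
    integrableOn_Ioi_of_integrable_weightMeasure μ (G.integrable_weight hμ)
  have hcont : ContinuousWithinAt (fun x : ℝ => x ^ (2 * μ) • Q x) (Ici 0) 0 :=
    ((Real.continuous_rpow_const (by positivity)).smul Q.continuous).continuousWithinAt
  have htop : Tendsto (fun x : ℝ => x ^ (2 * μ) • Q x) atTop (𝓝 0) := by
    have h1 : (fun x : ℝ => Q x) =O[atTop] fun x : ℝ => x ^ (-(2 * μ) - 1) := by
      refine ((isBigO_cocompact_rpow Q (-(2 * μ) - 1)).mono atTop_le_cocompact).congr'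
        EventuallyEq.rfl ?_
      filter_upwards [eventually_gt_atTop 0] with x hx
      rw [Real.norm_of_nonneg hx.le]
    have h2 : (fun x : ℝ => x ^ (2 * μ) • Q x) =O[atTop] fun x : ℝ => x⁻¹ := by
      refine ((Asymptotics.isBigO_refl (fun x : ℝ => x ^ (2 * μ)) atTop).smul h1).congr'
        EventuallyEq.rfl ?_
      filter_upwards [eventually_gt_atTop 0] with x hx
      rw [smul_eq_mul, ← Real.rpow_add hx, ← Real.rpow_neg_one]
      congr 1
      ring
    exact h2.trans_tendsto tendsto_inv_atTop_zero
  have h0 := integral_Ioi_of_hasDerivAt_of_tendsto hcont hder hint htop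
  rw [← integral_weightMeasure_eq_Ioi μ (G.integrable_weight hμ), Real.zero_rpow (by positivity),
    zero_smul, sub_zero, ← hsum] at h0
  exact eq_neg_of_add_eq_zero_left h0

/-! ### The Gaussian, the ladder and the Dunkl oscillator -/

/-- The Gaussian `exp (-x² / 2)`. -/
noncomputable def gaussian : 𝓢(ℝ, ℝ) where
  toFun x := Real.exp (-(x ^ 2 / 2))
  smooth' := by fun_prop
  decay' k n := by
    have hm : ∀ m : ℕ, ∃ C : ℝ, ∀ x : ℝ, |x| ^ m * Real.exp (-(x ^ 2 / 2)) ≤ C := by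
      intro m
      -- From `|x|^m ≤ 1 + (x²)^m` and the term of order `m` in the series of `exp (x² / 2)`.
      refine ⟨1 + 2 ^ m * m.factorial, fun x => ?_⟩
      have h1 : |x| ^ m ≤ 1 + (x ^ 2) ^ m := by
        have h2 : (x ^ 2) ^ m = (|x| ^ m) ^ 2 := by rw [← sq_abs, ← pow_mul, ← pow_mul, mul_comm]
        rw [h2]
        nlinarith [sq_nonneg (|x| ^ m - 1 / 2)]
      have h3 := Real.pow_div_factorial_le_exp (x := x ^ 2 / 2) (by positivity) m
      have hf : (0 : ℝ) < m.factorial := by exact_mod_cast m.factorial_pos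
      rw [div_le_iff₀ hf, div_pow, div_le_iff₀ (by positivity)] at h3
      have h4 : 1 ≤ Real.exp (x ^ 2 / 2) := Real.one_le_exp (by positivity)
      rw [Real.exp_neg, ← div_eq_mul_inv, div_le_iff₀ (Real.exp_pos _)]
      nlinarith
    have hp : ∀ (p : Polynomial ℝ) (k : ℕ),
        ∃ C : ℝ, ∀ x : ℝ, |x| ^ k * |p.eval x| * Real.exp (-(x ^ 2 / 2)) ≤ C := by
      intro p
      induction p using Polynomial.induction_on' with
      | add p q hp hq =>
        intro k
        obtain ⟨C, hC⟩ := hp k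
        obtain ⟨C', hC'⟩ := hq k
        refine ⟨C + C', fun x => ?_⟩
        have h := hC x
        have h' := hC' x
        rw [Polynomial.eval_add]
        calc _ ≤ |x| ^ k * (|p.eval x| + |q.eval x|) * Real.exp (-(x ^ 2 / 2)) := by
              gcongr
              exact abs_add_le _ _
          _ ≤ C + C' := by linarith
      | monomial n a =>
        intro k
        obtain ⟨C, hC⟩ := hm (k + n)
        refine ⟨|a| * C, fun x => ?_⟩
        have h := mul_le_mul_of_nonneg_left (hC x) (abs_nonneg a)
        rw [Polynomial.eval_monomial, abs_mul, abs_pow]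
        refine le_trans (le_of_eq ?_) h
        ring
    -- The derivatives of the Gaussian are, up to sign, Hermite polynomials times the Gaussian.
    obtain ⟨C, hC⟩ := hp ((Polynomial.hermite n).map (Int.castRingHom ℝ)) k
    refine ⟨C, fun x => ?_⟩
    rw [norm_iteratedFDeriv_eq_norm_iteratedDeriv, iteratedDeriv_eq_iterate,
      Polynomial.deriv_gaussian_eq_hermite_mul_gaussian]
    have h := hC x
    rw [Polynomial.eval_map, ← algebraMap_int_eq, ← Polynomial.aeval_def] at h
    rw [Real.norm_eq_abs, Real.norm_eq_abs, abs_mul, abs_mul, abs_pow, abs_neg, abs_one, one_pow,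
      one_mul, abs_of_pos (Real.exp_pos _), ← mul_assoc]
    exact h

/-- The complex-valued Gaussian `exp (-x² / 2)`. -/
noncomputable def complexGaussian : 𝓢(ℝ, ℂ) := postcompCLM Complex.ofRealCLM gaussian

theorem complexGaussian_apply (x : ℝ) :
    complexGaussian x = (Real.exp (-(x ^ 2 / 2)) : ℝ) := rfl

/-- The functions obtained from the Gaussian by the raising operator `x - D`. -/
noncomputable def hermiteLadder (μ : ℝ) : ℕ → 𝓢(ℝ, ℂ)
  | 0 => complexGaussian
  | n + 1 => mulX (hermiteLadder μ n) - dunkl μ (hermiteLadder μ n)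

/-- The deformed integers `n` (`n` even), `n + 2 μ` (`n` odd). -/
noncomputable def deformedInt (μ : ℝ) (n : ℕ) : ℝ := n + if Even n then 0 else 2 * μ

theorem deformedInt_add (μ : ℝ) (n : ℕ) :
    deformedInt μ n + deformedInt μ (n + 1) = 2 * n + 1 + 2 * μ := by
  rcases Nat.even_or_odd n with h | h
  · simp [deformedInt, h, Nat.even_add_one]
    ring
  · have h' : ¬Even n := Nat.not_even_iff_odd.2 h
    simp [deformedInt, h', Nat.even_add_one]
    ring

/-- Both `x` and `D` anticommute with the reflection, hence so does `x - D`, and the Gaussian is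
even. -/
theorem reflect_hermiteLadder (μ : ℝ) (n : ℕ) :
    reflect (hermiteLadder μ n) = (-1 : ℂ) ^ n • hermiteLadder μ n := by
  induction n with
  | zero =>
    ext x
    simp [hermiteLadder, complexGaussian_apply]
  | succ n ih =>
    have h : dunkl μ (reflect (hermiteLadder μ n)) =
        (-1 : ℂ) ^ n • dunkl μ (hermiteLadder μ n) := by
      rw [ih, dunkl_smul]
    rw [dunkl_reflect] at h
    have h' := reflect_mulX (hermiteLadder μ n)
    rw [ih, map_smul] at h'
    rw [hermiteLadder, map_sub, h', ← neg_neg (reflect (dunkl _ _)), h, pow_succ]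
    ext x
    simp
    ring

theorem dunkl_complexGaussian (μ : ℝ) : dunkl μ complexGaussian = -mulX complexGaussian := by
  refine ext_off_zero fun x hx => ?_
  have h : HasDerivAt (fun y : ℝ => ((Real.exp (-(y ^ 2 / 2)) : ℝ) : ℂ))
      ((Real.exp (-(x ^ 2 / 2)) * (-x) : ℝ) : ℂ) x := by
    have h1 : HasDerivAt (fun y : ℝ => Real.exp (-(y ^ 2 / 2)))
        (Real.exp (-(x ^ 2 / 2)) * (-x)) x := by
      have h2 : HasDerivAt (fun y : ℝ => -(y ^ 2 / 2)) (-x) x := by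
        have := ((hasDerivAt_pow 2 x).div_const 2).neg
        refine this.congr_deriv ?_
        simp
      exact h2.exp
    exact h1.ofReal_comp
  have h' : deriv complexGaussian x = ((Real.exp (-(x ^ 2 / 2)) * (-x) : ℝ) : ℂ) := h.deriv
  rw [dunkl_apply μ _ hx, h', neg_apply, mulX_apply]
  simp [complexGaussian_apply]
  ring

/-- The lowering operator `x + D` acts on the ladder. -/
theorem lower_hermiteLadder_succ (μ : ℝ) (n : ℕ) :
    mulX (hermiteLadder μ (n + 1)) + dunkl μ (hermiteLadder μ (n + 1)) =
      (2 * deformedInt μ (n + 1) : ℂ) • hermiteLadder μ n := by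
  -- This is `(x + D)(x - D) = (x - D)(x + D) + 2 [D, x]`, where `[D, x] = 1 + 2μR` and `R = (-1)^n`
  -- on the ladder function of index `n`. The added constant is twice the increment from
  -- `deformedInt μ n` to `deformedInt μ (n + 1)`.
  have key : ∀ n, mulX (hermiteLadder μ (n + 1)) + dunkl μ (hermiteLadder μ (n + 1)) =
      (mulX (mulX (hermiteLadder μ n) + dunkl μ (hermiteLadder μ n)) -
        dunkl μ (mulX (hermiteLadder μ n) + dunkl μ (hermiteLadder μ n))) +
      (2 * (1 + 2 * μ * (-1) ^ n) : ℂ) • hermiteLadder μ n := by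
    intro n
    rw [hermiteLadder, dunkl_sub, dunkl_add, dunkl_mulX, reflect_hermiteLadder, map_sub, map_add]
    ext x
    simp
    ring
  induction n with
  | zero =>
    rw [key, hermiteLadder, dunkl_complexGaussian]
    ext x
    have h : dunkl μ (0 : 𝓢(ℝ, ℂ)) = 0 := by simpa using dunkl_smul μ 0 0
    simp [deformedInt, h]
  | succ n ih =>
    rw [key, ih, map_smul, dunkl_smul]
    rw [show hermiteLadder μ (n + 1) = mulX (hermiteLadder μ n) - dunkl μ (hermiteLadder μ n)
      from rfl]
    ext x
    rcases Nat.even_or_odd n with h | h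
    · have h' : ¬Even (n + 1) := by simpa [Nat.even_add_one] using h
      simp [deformedInt, Nat.even_add_one, h, pow_succ]
      ring
    · have h' : ¬Even n := Nat.not_even_iff_odd.2 h
      simp [deformedInt, Nat.even_add_one, h', h.neg_one_pow, pow_succ]
      ring

theorem lower_hermiteLadder_zero (μ : ℝ) :
    mulX (hermiteLadder μ 0) + dunkl μ (hermiteLadder μ 0) = 0 := by
  rw [hermiteLadder, dunkl_complexGaussian, add_neg_cancel]

/-- The oscillator `-D² / 2 + x² / 2` for the Dunkl operator `D`. -/
noncomputable def oscillator (μ : ℝ) (φ : 𝓢(ℝ, ℂ)) : 𝓢(ℝ, ℂ) :=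
  (-(1 / 2) : ℂ) • dunkl μ (dunkl μ φ) + (1 / 2 : ℂ) • mulX (mulX φ)

theorem weightedPairing_oscillator {μ : ℝ} (hμ : 0 < μ) (φ ψ : 𝓢(ℝ, ℂ)) :
    weightedPairing μ (oscillator μ φ) ψ = weightedPairing μ φ (oscillator μ ψ) := by
  rw [weightedPairing_comm μ φ]
  simp only [oscillator, weightedPairing_add_left hμ, weightedPairing_smul_left]
  rw [weightedPairing_dunkl hμ, weightedPairing_dunkl hμ, weightedPairing_mulX,
    weightedPairing_mulX, weightedPairing_comm μ φ (dunkl μ _),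
    weightedPairing_comm μ φ (mulX _)]
  ring

/-- The oscillator is a quarter of `(x - D)(x + D) + (x + D)(x - D)`. On the ladder the two products
act by twice the deformed integers of `n` and `n + 1`, whose sum no longer depends on parity. -/
theorem oscillator_hermiteLadder (μ : ℝ) (n : ℕ) :
    oscillator μ (hermiteLadder μ n) = ((n + 1 / 2 + μ : ℝ) : ℂ) • hermiteLadder μ n := by
  have h1 : (2 : ℂ) • dunkl μ (dunkl μ (hermiteLadder μ n)) = 
      (2 : ℂ) • mulX (mulX (hermiteLadder μ n)) - 
      (mulX (mulX (hermiteLadder μ n) + dunkl μ (hermiteLadder μ n)) - 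
        dunkl μ (mulX (hermiteLadder μ n) + dunkl μ (hermiteLadder μ n))) - 
      (mulX (hermiteLadder μ (n + 1)) + dunkl μ (hermiteLadder μ (n + 1))) := by
    rw [hermiteLadder, dunkl_sub, dunkl_add, map_sub, map_add]
    ext x
    simp
    ring
  have h2 : oscillator μ (hermiteLadder μ n) = (1 / 4 : ℂ) •
      ((2 : ℂ) • mulX (mulX (hermiteLadder μ n)) -
        (2 : ℂ) • dunkl μ (dunkl μ (hermiteLadder μ n))) := by
    rw [oscillator]
    ext x
    simp
    ring
  have h3 := deformedInt_add μ n
  rw [h2, h1, lower_hermiteLadder_succ]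
  cases n with
  | zero =>
    have h : dunkl μ (0 : 𝓢(ℝ, ℂ)) = 0 := by simpa using dunkl_smul μ 0 0
    rw [lower_hermiteLadder_zero, h]
    ext x
    simp [deformedInt]
    ring
  | succ n =>
    have h4 : (deformedInt μ (n + 1) : ℂ) =
        2 * ((n + 1 : ℕ) : ℂ) + 1 + 2 * μ - deformedInt μ (n + 1 + 1) := by
      rw [eq_sub_iff_add_eq]
      exact_mod_cast h3
    rw [lower_hermiteLadder_succ, map_smul, dunkl_smul, ← smul_sub,
      show mulX (hermiteLadder μ n) - dunkl μ (hermiteLadder μ n) = hermiteLadder μ (n + 1)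
        from rfl, h4]
    ext x
    simp
    ring

/-- Eigenfunctions of a symmetric operator for distinct eigenvalues. -/
theorem weightedPairing_hermiteLadder_of_ne {μ : ℝ} (hμ : 0 < μ) {n m : ℕ} (h : n ≠ m) :
    weightedPairing μ (hermiteLadder μ n) (hermiteLadder μ m) = 0 := by
  have h1 := weightedPairing_oscillator hμ (hermiteLadder μ n) (hermiteLadder μ m)
  rw [oscillator_hermiteLadder, oscillator_hermiteLadder, weightedPairing_smul_left,
    weightedPairing_comm, weightedPairing_comm _ (hermiteLadder μ n), weightedPairing_smul_left,
    ← sub_eq_zero, ← sub_mul, mul_eq_zero, weightedPairing_comm] at h1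
  refine h1.resolve_left fun h2 => h ?_
  rw [sub_eq_zero, Complex.ofReal_inj] at h2
  have h3 : (n : ℝ) = m := by linarith
  exact_mod_cast h3

theorem weightedPairing_complexGaussian {μ : ℝ} (hμ : 0 < μ) :
    weightedPairing μ complexGaussian complexGaussian = (Real.Gamma (μ + 1 / 2) : ℝ) := by
  refine (integral_weightMeasure_eq_Ioi μ
    ((product complexGaussian complexGaussian).integrable_weight hμ)).trans ?_
  have h := integral_rpow_mul_exp_neg_rpow (p := 2) (q := 2 * μ) two_pos (by linarith)
  have h1 : (1 / 2 : ℝ) * Real.Gamma ((2 * μ + 1) / 2) = 1 / 2 * Real.Gamma (μ + 1 / 2) := by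
    congr 2
    ring
  rw [h1] at h
  have h2 : Real.Gamma (μ + 1 / 2) =
      2 * ∫ x in Ioi (0 : ℝ), x ^ (2 * μ) * Real.exp (-x ^ (2 : ℝ)) := by
    rw [h]
    ring
  rw [h2, ← integral_const_mul, ← integral_complex_ofReal]
  refine setIntegral_congr_fun measurableSet_Ioi fun x hx => ?_
  have h3 : Real.exp (-x ^ (2 : ℝ)) = Real.exp (-(x ^ 2 / 2)) * Real.exp (-(x ^ 2 / 2)) := by
    rw [← Real.exp_add, Real.rpow_two]
    congr 1
    ring
  simp only [product_apply, complexGaussian_apply, h3, neg_sq, Complex.real_smul]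
  push_cast
  ring

/-- `x - D` and `x + D` are transposes of each other for the pairing. -/
theorem weightedPairing_hermiteLadder_succ {μ : ℝ} (hμ : 0 < μ) (n : ℕ) :
    weightedPairing μ (hermiteLadder μ (n + 1)) (hermiteLadder μ (n + 1)) =
      (2 * deformedInt μ (n + 1) : ℂ) *
        weightedPairing μ (hermiteLadder μ n) (hermiteLadder μ n) := by
  rw [← weightedPairing_smul_left, ← lower_hermiteLadder_succ, weightedPairing_add_left hμ,
    weightedPairing_mulX, weightedPairing_dunkl hμ, ← sub_eq_add_neg,
    weightedPairing_comm μ _ (mulX (hermiteLadder μ n)),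
    weightedPairing_comm μ _ (dunkl μ (hermiteLadder μ n)), ← weightedPairing_sub_left hμ]
  rfl

/-- The squared norms of the ladder functions. -/
theorem weightedPairing_hermiteLadder_self {μ : ℝ} (hμ : 0 < μ) (n : ℕ) :
    weightedPairing μ (hermiteLadder μ n) (hermiteLadder μ n) =
      ((2 ^ (2 * n) * Real.Gamma ((n / 2 : ℕ) + 1) *
        Real.Gamma (((n + 1) / 2 : ℕ) + μ + 1 / 2) : ℝ) : ℂ) := by
  induction n with
  | zero => simpa [hermiteLadder] using weightedPairing_complexGaussian hμ
  | succ n ih =>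
    rw [weightedPairing_hermiteLadder_succ hμ, ih]
    rw [← Complex.ofReal_ofNat, ← Complex.ofReal_mul, ← Complex.ofReal_mul, Complex.ofReal_inj]
    -- The new factor is `4 (m + μ + 1/2)` for `n = 2m` and `4 (m + 1)` for `n = 2m + 1`; it
    -- advances the second and the first Gamma factor alternately.
    rcases Nat.even_or_odd n with ⟨m, hm⟩ | ⟨m, hm⟩
    · have e1 : n / 2 = m := by omega
      have e2 : (n + 1) / 2 = m := by omega
      have e3 : (n + 1 + 1) / 2 = m + 1 := by omega
      have h' : ¬Even (n + 1) := by rw [Nat.not_even_iff_odd]; exact ⟨m, by omega⟩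
      have hn : (n : ℝ) = 2 * m := by rw [hm]; push_cast; ring
      have hG : Real.Gamma (((m + 1 : ℕ) : ℝ) + μ + 1 / 2) =
          (m + μ + 1 / 2) * Real.Gamma (m + μ + 1 / 2) := by
        rw [← Real.Gamma_add_one (by positivity)]
        congr 1
        push_cast
        ring
      rw [e1, e2, e3, hG, deformedInt, if_neg h']
      push_cast
      rw [hn, show 2 * (n + 1) = 2 * n + 2 by ring, pow_add]
      ring
    · have e1 : n / 2 = m := by omega
      have e2 : (n + 1) / 2 = m + 1 := by omega
      have e3 : (n + 1 + 1) / 2 = m + 1 := by omega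
      have h' : Even (n + 1) := ⟨m + 1, by omega⟩
      have hn : (n : ℝ) = 2 * m + 1 := by rw [hm]; push_cast; ring
      have hG : Real.Gamma (((m + 1 : ℕ) : ℝ) + 1) = (m + 1) * Real.Gamma (m + 1) := by
        rw [Real.Gamma_add_one (by positivity)]
        push_cast
        ring
      rw [e1, e2, e3, hG, deformedInt, if_pos h']
      push_cast
      rw [hn, show 2 * (n + 1) = 2 * n + 2 by ring, pow_add]
      ring

end SchwartzMap

/-! ### Laguerre recurrences and the generalized Hermite polynomials -/

namespace RadialLines

open Polynomial

theorem prod_Ioc_eq_prod_range (f : ℕ → ℝ) (k d : ℕ) :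
    ∏ i ∈ Finset.Ioc k (k + d), f i = ∏ i ∈ Finset.range d, f (k + 1 + i) := by
  induction d with
  | zero => simp
  | succ d ih =>
    rw [← add_assoc, Finset.prod_Ioc_succ_top (by omega), ih, Finset.prod_range_succ]
    congr 2
    ring

/-- Writing the degree as `k + d` avoids truncated subtraction and gives products over `range d`,
which can be compared by shifting the index. -/
theorem coeff_laguerre (α : ℝ) (k d : ℕ) :
    (laguerre α (k + d)).coeff k =
      (-1) ^ k * (∏ i ∈ Finset.range d, (α + (k + 1 + i : ℕ))) / (d.factorial * k.factorial) := by
  rw [laguerre, finsetSum_coeff, Finset.sum_eq_single_of_mem k (by simp)]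
  · rw [coeff_C_mul, coeff_X_pow_self, mul_one, prod_Ioc_eq_prod_range, Nat.add_sub_cancel_left]
  · intro j _ hj
    rw [coeff_C_mul, coeff_X_pow, if_neg (Ne.symm hj), mul_zero]

theorem coeff_laguerre_of_lt (α : ℝ) {n k : ℕ} (h : n < k) : (laguerre α n).coeff k = 0 := by
  rw [laguerre, finsetSum_coeff]
  refine Finset.sum_eq_zero fun j hj => ?_
  rw [Finset.mem_range] at hj
  rw [coeff_C_mul, coeff_X_pow, if_neg (by omega), mul_zero]

/-- With `α = μ - 1/2`, this is the Hermite recurrence from even to odd degree. -/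
theorem laguerre_add_one (α : ℝ) (m : ℕ) :
    laguerre (α + 1) m = laguerre α m - derivative (laguerre α m) := by
  ext k
  rw [coeff_sub, coeff_derivative]
  rcases lt_trichotomy m k with h | rfl | h
  · rw [coeff_laguerre_of_lt _ h, coeff_laguerre_of_lt _ h, coeff_laguerre_of_lt _ (by omega)]
    ring
  · have h1 := coeff_laguerre (α + 1) m 0
    have h2 := coeff_laguerre α m 0
    rw [add_zero] at h1 h2
    rw [h1, h2, coeff_laguerre_of_lt _ (by omega)]
    simp
  · obtain ⟨d, rfl⟩ := Nat.exists_eq_add_of_lt h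
    have h3 := coeff_laguerre α (k + 1) d
    rw [show k + 1 + d = k + d + 1 by ring] at h3
    have h1 := coeff_laguerre (α + 1) k (d + 1)
    have h2 := coeff_laguerre α k (d + 1)
    rw [← add_assoc] at h1 h2
    rw [h1, h2, h3, Finset.prod_range_succ, Finset.prod_range_succ' _ d]
    have e1 : ∏ i ∈ Finset.range d, (α + 1 + (k + 1 + i : ℕ)) =
        ∏ i ∈ Finset.range d, (α + (k + 1 + 1 + i : ℕ)) :=
      Finset.prod_congr rfl fun i _ => by push_cast; ring
    have e2 : ∏ i ∈ Finset.range d, (α + (k + 1 + (i + 1) : ℕ)) =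
        ∏ i ∈ Finset.range d, (α + (k + 1 + 1 + i : ℕ)) :=
      Finset.prod_congr rfl fun i _ => by push_cast; ring
    rw [e1, e2, Nat.factorial_succ, Nat.factorial_succ]
    have hd : (d.factorial : ℝ) ≠ 0 := by exact_mod_cast d.factorial_ne_zero
    have hk : (k.factorial : ℝ) ≠ 0 := by exact_mod_cast k.factorial_ne_zero
    push_cast
    field_simp
    ring

/-- With `α = μ - 1/2`, this is the Hermite recurrence from odd to even degree; the reflection part
of `D` accounts for `α + 1` in place of `1/2`. -/
theorem laguerre_succ (α : ℝ) (m : ℕ) :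
    C ((m : ℝ) + 1) * laguerre α (m + 1) = C (α + 1) * laguerre (α + 1) m +
      X * derivative (laguerre (α + 1) m) - X * laguerre (α + 1) m := by
  ext k
  rw [coeff_sub, coeff_add, coeff_C_mul, coeff_C_mul]
  cases k with
  | zero =>
    simp only [coeff_X_mul_zero]
    have h1 := coeff_laguerre α 0 (m + 1)
    have h2 := coeff_laguerre (α + 1) 0 m
    rw [zero_add] at h1 h2
    rw [h1, h2, Finset.prod_range_succ']
    have e1 : ∏ i ∈ Finset.range m, (α + (0 + 1 + (i + 1) : ℕ)) =
        ∏ i ∈ Finset.range m, (α + 1 + (0 + 1 + i : ℕ)) :=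
      Finset.prod_congr rfl fun i _ => by push_cast; ring
    rw [e1, Nat.factorial_succ]
    have hm : (m.factorial : ℝ) ≠ 0 := by exact_mod_cast m.factorial_ne_zero
    push_cast
    field_simp
    ring
  | succ k =>
    rw [coeff_X_mul, coeff_X_mul, coeff_derivative]
    rcases lt_trichotomy m k with h | rfl | h
    · rw [coeff_laguerre_of_lt _ h, coeff_laguerre_of_lt _ (by omega),
        coeff_laguerre_of_lt _ (by omega)]
      ring
    · have h1 := coeff_laguerre α (m + 1) 0
      have h2 := coeff_laguerre (α + 1) m 0
      rw [add_zero] at h1 h2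
      rw [h1, h2, coeff_laguerre_of_lt _ (by omega), Nat.factorial_succ]
      have hm : (m.factorial : ℝ) ≠ 0 := by exact_mod_cast m.factorial_ne_zero
      push_cast
      simp only [Finset.range_zero, Finset.prod_empty, Nat.factorial_zero, Nat.cast_one]
      field_simp
      ring
    · obtain ⟨d, rfl⟩ := Nat.exists_eq_add_of_lt h
      have h3 := coeff_laguerre α (k + 1) (d + 1)
      rw [show k + 1 + (d + 1) = k + d + 1 + 1 by ring] at h3
      have h1 := coeff_laguerre (α + 1) (k + 1) d
      rw [show k + 1 + d = k + d + 1 by ring] at h1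
      have h2 := coeff_laguerre (α + 1) k (d + 1)
      rw [← add_assoc] at h2
      rw [h1, h2, h3, Finset.prod_range_succ' _ d, Finset.prod_range_succ' _ d]
      have e1 : ∏ i ∈ Finset.range d, (α + 1 + (k + 1 + 1 + i : ℕ)) =
          ∏ i ∈ Finset.range d, (α + (k + 1 + 1 + (i + 1) : ℕ)) :=
        Finset.prod_congr rfl fun i _ => by push_cast; ring
      have e2 : ∏ i ∈ Finset.range d, (α + 1 + (k + 1 + (i + 1) : ℕ)) =
          ∏ i ∈ Finset.range d, (α + (k + 1 + 1 + (i + 1) : ℕ)) :=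
        Finset.prod_congr rfl fun i _ => by push_cast; ring
      rw [e1, e2, Nat.factorial_succ, Nat.factorial_succ]
      have hd : (d.factorial : ℝ) ≠ 0 := by exact_mod_cast d.factorial_ne_zero
      have hk : (k.factorial : ℝ) ≠ 0 := by exact_mod_cast k.factorial_ne_zero
      push_cast
      field_simp
      ring

theorem genHermite_even (μ : ℝ) (m : ℕ) (x : ℝ) :
    (genHermite μ (2 * m)).eval x =
      (-1) ^ m * 2 ^ (2 * m) * m.factorial * (laguerre (μ - 1 / 2) m).eval (x ^ 2) := by
  rw [genHermite, if_pos (even_two_mul m), show 2 * m / 2 = m by omega, eval_C_mul, eval_comp,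
    eval_pow, eval_X]

theorem genHermite_odd (μ : ℝ) (m : ℕ) (x : ℝ) :
    (genHermite μ (2 * m + 1)).eval x =
      (-1) ^ m * 2 ^ (2 * m + 1) * m.factorial * (x * (laguerre (μ + 1 / 2) m).eval (x ^ 2)) := by
  rw [genHermite, if_neg (by simp), show (2 * m + 1) / 2 = m by omega,
    eval_C_mul, eval_mul, eval_comp, eval_pow, eval_X]

theorem hasDerivAt_eval_sq (p : ℝ[X]) (x : ℝ) :
    HasDerivAt (fun y : ℝ => p.eval (y ^ 2)) (p.derivative.eval (x ^ 2) * (2 * x)) x := by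
  have h := (p.hasDerivAt (x ^ 2)).comp x (hasDerivAt_pow 2 x)
  refine h.congr_deriv ?_
  simp

/-- The recurrence `H_{n+1} = 2 x H_n - D H_n` of the generalized Hermite polynomials. -/
theorem genHermite_succ (μ : ℝ) (n : ℕ) {x : ℝ} (hx : x ≠ 0) :
    (genHermite μ (n + 1)).eval x = 2 * x * (genHermite μ n).eval x -
      (genHermite μ n).derivative.eval x -
      μ * ((genHermite μ n).eval x - (genHermite μ n).eval (-x)) / x := by
  rcases Nat.even_or_odd' n with ⟨m, rfl | rfl⟩
  · have hd : (genHermite μ (2 * m)).derivative.eval x = (-1) ^ m * 2 ^ (2 * m) * m.factorial *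
        ((laguerre (μ - 1 / 2) m).derivative.eval (x ^ 2) * (2 * x)) := by
      refine ((genHermite μ (2 * m)).hasDerivAt x).unique ?_
      have h : (fun y => (genHermite μ (2 * m)).eval y) = fun y => (-1) ^ m * 2 ^ (2 * m) *
          m.factorial * (laguerre (μ - 1 / 2) m).eval (y ^ 2) := funext (genHermite_even μ m)
      rw [h]
      exact (hasDerivAt_eval_sq _ x).const_mul _
    have hL := congrArg (eval (x ^ 2)) (laguerre_add_one (μ - 1 / 2) m)
    rw [show μ - 1 / 2 + 1 = μ + 1 / 2 by ring, eval_sub] at hL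
    rw [genHermite_odd, hd, genHermite_even, genHermite_even, neg_sq, hL]
    ring
  · have hd : (genHermite μ (2 * m + 1)).derivative.eval x =
        (-1) ^ m * 2 ^ (2 * m + 1) * m.factorial *
          (1 * (laguerre (μ + 1 / 2) m).eval (x ^ 2) +
            x * ((laguerre (μ + 1 / 2) m).derivative.eval (x ^ 2) * (2 * x))) := by
      refine ((genHermite μ (2 * m + 1)).hasDerivAt x).unique ?_
      have h : (fun y => (genHermite μ (2 * m + 1)).eval y) = fun y => (-1) ^ m * 2 ^ (2 * m + 1) *
          m.factorial * (y * (laguerre (μ + 1 / 2) m).eval (y ^ 2)) :=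
        funext (genHermite_odd μ m)
      rw [h]
      exact ((hasDerivAt_id x).mul (hasDerivAt_eval_sq _ x)).const_mul _
    have hL := congrArg (eval (x ^ 2)) (laguerre_succ (μ - 1 / 2) m)
    rw [show μ - 1 / 2 + 1 = μ + 1 / 2 by ring] at hL
    simp only [eval_sub, eval_add, eval_mul, eval_C, eval_X] at hL
    have hE := genHermite_even μ (m + 1) x
    rw [show 2 * (m + 1) = 2 * m + 1 + 1 by ring] at hE
    rw [hE, hd, genHermite_odd, genHermite_odd, neg_sq, Nat.factorial_succ]
    push_cast
    have h2 : (-1 : ℝ) ^ (m + 1) * 2 ^ (2 * m + 1 + 1) * ((m + 1) * m.factorial) *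
        (laguerre (μ - 1 / 2) (m + 1)).eval (x ^ 2) = (-1 : ℝ) ^ (m + 1) * 2 ^ (2 * m + 1 + 1) *
          m.factorial * ((m + 1) * (laguerre (μ - 1 / 2) (m + 1)).eval (x ^ 2)) := by ring
    rw [h2, hL]
    field_simp
    ring

-- As the Gaussian is even, `x - D` acts on a polynomial `p` times the Gaussian as `p ↦ 2 x p - D
-- p`, which is the Hermite recurrence; the origin is filled in by continuity.
open SchwartzMap in
theorem hermiteLadder_apply (μ : ℝ) (n : ℕ) (x : ℝ) :
    hermiteLadder μ n x = ((Real.exp (-(x ^ 2 / 2)) * (genHermite μ n).eval x : ℝ) : ℂ) := by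
  induction n generalizing x with
  | zero => simp [hermiteLadder, complexGaussian_apply, genHermite, laguerre]
  | succ n ih =>
    have hfun : (hermiteLadder μ n : ℝ → ℂ) =
        fun x => ((Real.exp (-(x ^ 2 / 2)) * (genHermite μ n).eval x : ℝ) : ℂ) := funext ih
    have hd : ∀ x : ℝ, deriv (hermiteLadder μ n) x = ((Real.exp (-(x ^ 2 / 2)) * (-x) *
        (genHermite μ n).eval x +
          Real.exp (-(x ^ 2 / 2)) * (genHermite μ n).derivative.eval x : ℝ) : ℂ) := by
      intro x
      rw [hfun]
      have h1 : HasDerivAt (fun y : ℝ => Real.exp (-(y ^ 2 / 2)))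
          (Real.exp (-(x ^ 2 / 2)) * (-x)) x := by
        have h2 : HasDerivAt (fun y : ℝ => -(y ^ 2 / 2)) (-x) x := by
          refine ((hasDerivAt_pow 2 x).div_const 2).neg.congr_deriv ?_
          simp
        exact h2.exp
      exact (h1.mul ((genHermite μ n).hasDerivAt x)).ofReal_comp.deriv
    have hoff : ∀ y : ℝ, y ≠ 0 → hermiteLadder μ (n + 1) y =
        ((Real.exp (-(y ^ 2 / 2)) * (genHermite μ (n + 1)).eval y : ℝ) : ℂ) := by
      intro y hy
      have hy' : (y : ℂ) ≠ 0 := Complex.ofReal_ne_zero.2 hy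
      rw [hermiteLadder, sub_apply, mulX_apply, dunkl_apply μ _ hy, hd, ih, ih,
        genHermite_succ μ n hy, neg_sq]
      push_cast
      field_simp
      ring
    have hcont : Continuous fun x : ℝ =>
        ((Real.exp (-(x ^ 2 / 2)) * (genHermite μ (n + 1)).eval x : ℝ) : ℂ) :=
      Complex.continuous_ofReal.comp
        ((by fun_prop : Continuous fun x : ℝ => Real.exp (-(x ^ 2 / 2))).mul
          (genHermite μ (n + 1)).continuous)
    exact congrFun (Continuous.ext_on (dense_compl_singleton (0 : ℝ))
      (hermiteLadder μ (n + 1)).continuous hcont fun y hy => hoff y hy) x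

/-! ### Roots of unity and components of functions on the lines -/

open SchwartzMap

theorem isPrimitiveRoot_omega {r : ℕ} (h0 : r ≠ 0) : IsPrimitiveRoot (omega r) r :=
  Complex.isPrimitiveRoot_exp r h0

theorem isPrimitiveRoot_eps {r : ℕ} (h0 : r ≠ 0) : IsPrimitiveRoot (eps r) (2 * r) := by
  have h := Complex.isPrimitiveRoot_exp (2 * r) (by omega)
  have h1 : 2 * Real.pi * Complex.I / ((2 * r : ℕ) : ℂ) = Real.pi * Complex.I / r := by
    have : (r : ℂ) ≠ 0 := by exact_mod_cast h0
    push_cast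
    field_simp
  rwa [h1] at h

theorem eps_pow {r : ℕ} (h0 : r ≠ 0) : eps r ^ r = -1 := by
  have : (r : ℂ) ≠ 0 := by exact_mod_cast h0
  rw [eps, ← Complex.exp_nat_mul, mul_div_cancel₀ _ this, Complex.exp_pi_mul_I]

/-- Orthogonality of the characters of a cyclic group, used for `ω` of order `r` and `ε` of order
`2r`. -/
theorem sum_inv_mul_pow {ζ : ℂ} {n : ℕ} (hζ : IsPrimitiveRoot ζ n) {i j : ℕ} (hi : i < n)
    (hj : j < n) :
    ∑ k ∈ Finset.range n, (ζ ^ (i * k))⁻¹ * ζ ^ (j * k) = if i = j then (n : ℂ) else 0 := by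
  have hn : n ≠ 0 := by omega
  have hζ0 : ζ ≠ 0 := hζ.ne_zero hn
  have h1 : ∀ k ∈ Finset.range n, (ζ ^ (i * k))⁻¹ * ζ ^ (j * k) = ((ζ ^ i)⁻¹ * ζ ^ j) ^ k :=
    fun k _ => by rw [mul_pow, inv_pow, pow_mul, pow_mul]
  rw [Finset.sum_congr rfl h1]
  split_ifs with h
  · subst h
    rw [inv_mul_cancel₀ (pow_ne_zero _ hζ0)]
    simp
  · have hne : (ζ ^ i)⁻¹ * ζ ^ j ≠ 1 := fun h2 => by
      rw [inv_mul_eq_one₀ (pow_ne_zero _ hζ0)] at h2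
      exact h (hζ.pow_inj hi hj h2)
    rw [geom_sum_eq hne, mul_pow, inv_pow, ← pow_mul, ← pow_mul, mul_comm i, mul_comm j, pow_mul,
      pow_mul, hζ.pow_eq_one]
    simp

/-- Off the origin, `f = ∑ j < r, x ^ j * Φ_j (x ^ r)` on the lines. -/
def HasComponents (r : ℕ) (f : ℂ → ℂ) (Φ : ℕ → 𝓢(ℝ, ℂ)) : Prop :=
  ∀ (x : ℂ) (u : ℝ), u ≠ 0 → x ^ r = u → f x = ∑ j ∈ Finset.range r, x ^ j * Φ j u

/-- As `(ε^k x)^r = (-1)^k x^r`, this makes the dependence on `k` a sum of two characters. -/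
theorem apply_neg_one_pow_mul (φ : 𝓢(ℝ, ℂ)) (k : ℕ) (u : ℝ) :
    φ ((-1) ^ k * u) = (φ u + φ (-u)) / 2 + (-1) ^ k * ((φ u - φ (-u)) / 2) := by
  rcases Nat.even_or_odd k with h | h
  · rw [h.neg_one_pow, h.neg_one_pow, one_mul]
    ring
  · rw [h.neg_one_pow, h.neg_one_pow, neg_one_mul]
    ring

/-- Since `ε^r = -1`, the rotation by `ε` multiplies `x^j` times an even function of `x^r` by `ε^j`,
and `x^j` times an odd one by `ε^(j+r)`. Each projection selects one of these. -/
theorem HasComponents.reflProj {r : ℕ} {f : ℂ → ℂ} {Φ : ℕ → 𝓢(ℝ, ℂ)} (h0 : r ≠ 0)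
    (hf : HasComponents r f Φ) {x : ℂ} {u : ℝ} (hu : u ≠ 0) (hx : x ^ r = u) {i : ℕ}
    (hi : i < 2 * r) :
    reflProj r i f x = ∑ j ∈ Finset.range r, x ^ j *
      ((if i = j then 1 else 0) * ((Φ j u + Φ j (-u)) / 2) +
        (if i = j + r then 1 else 0) * ((Φ j u - Φ j (-u)) / 2)) := by
  have hε := isPrimitiveRoot_eps h0
  have hr0 : (r : ℂ) ≠ 0 := by exact_mod_cast h0
  have h1 : ∀ k, f (eps r ^ k * x) = ∑ j ∈ Finset.range r, x ^ j *
      (eps r ^ (j * k) * ((Φ j u + Φ j (-u)) / 2) +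
        eps r ^ ((j + r) * k) * ((Φ j u - Φ j (-u)) / 2)) := by
    intro k
    have h2 : (eps r ^ k * x) ^ r = (((-1) ^ k * u : ℝ) : ℂ) := by
      rw [mul_pow, ← pow_mul, mul_comm k, pow_mul, eps_pow h0, hx]
      push_cast
      rfl
    rw [hf _ _ (mul_ne_zero (pow_ne_zero _ (by norm_num)) hu) h2]
    refine Finset.sum_congr rfl fun j _ => ?_
    rw [apply_neg_one_pow_mul, add_mul, pow_add, pow_mul _ r, eps_pow h0, mul_pow, ← pow_mul,
      mul_comm k j]
    ring
  rw [RadialLines.reflProj]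
  simp only [h1, Finset.mul_sum]
  rw [Finset.sum_comm]
  refine Finset.sum_congr rfl fun j hj => ?_
  rw [Finset.mem_range] at hj
  have s1 := sum_inv_mul_pow hε hi (show j < 2 * r by omega)
  have s2 := sum_inv_mul_pow hε hi (show j + r < 2 * r by omega)
  have h3 : ∀ k, 1 / (2 * r : ℂ) * ((eps r ^ (i * k))⁻¹ * (x ^ j *
      (eps r ^ (j * k) * ((Φ j u + Φ j (-u)) / 2) +
        eps r ^ ((j + r) * k) * ((Φ j u - Φ j (-u)) / 2)))) =
      1 / (2 * r : ℂ) * x ^ j * ((Φ j u + Φ j (-u)) / 2) * ((eps r ^ (i * k))⁻¹ * eps r ^ (j * k)) +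
      1 / (2 * r : ℂ) * x ^ j * ((Φ j u - Φ j (-u)) / 2) *
        ((eps r ^ (i * k))⁻¹ * eps r ^ ((j + r) * k)) := fun k => by ring
  simp only [h3, Finset.sum_add_distrib, ← Finset.mul_sum, s1, s2]
  push_cast
  split_ifs <;> field_simp <;> ring

theorem HasComponents.alongDeriv {r : ℕ} {f : ℂ → ℂ} {Φ : ℕ → 𝓢(ℝ, ℂ)}
    (hf : HasComponents r f Φ) {x : ℂ} {u : ℝ} (hu : u ≠ 0) (hx : x ^ r = u) :
    alongDeriv f x = (∑ j ∈ Finset.range r, x ^ j * (j * Φ j u + r * u * deriv (Φ j) u)) / x := by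
  -- The points `(1 + t) x` stay on the line of `x` and, for small `t`, off the origin, where the
  -- components describe `f`.
  have h1 : (fun t : ℝ => f (x + t • x)) =ᶠ[𝓝 0] fun t : ℝ => ∑ j ∈ Finset.range r,
      (x ^ j * (((1 + t) ^ j : ℝ) : ℂ)) * Φ j ((1 + t) ^ r * u) := by
    have h2 : ∀ᶠ t : ℝ in 𝓝 0, 1 + t ≠ 0 := by
      refine ContinuousAt.eventually_ne (by fun_prop) (by norm_num)
    filter_upwards [h2] with t ht
    have h3 : x + t • x = (1 + t : ℝ) * x := by
      rw [Complex.real_smul]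
      push_cast
      ring
    have h4 : (x + t • x) ^ r = (((1 + t) ^ r * u : ℝ) : ℂ) := by
      rw [h3, mul_pow, hx]
      push_cast
      rfl
    rw [hf _ _ (mul_ne_zero (pow_ne_zero _ ht) hu) h4]
    refine Finset.sum_congr rfl fun j _ => ?_
    rw [h3, mul_pow]
    push_cast
    ring
  have h5 : HasDerivAt (fun t : ℝ => ∑ j ∈ Finset.range r,
      (x ^ j * (((1 + t) ^ j : ℝ) : ℂ)) * Φ j ((1 + t) ^ r * u))
      (∑ j ∈ Finset.range r, x ^ j * (j * Φ j u + r * u * deriv (Φ j) u)) 0 := by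
    refine HasDerivAt.fun_sum fun j _ => ?_
    have h6 : ∀ m : ℕ, HasDerivAt (fun t : ℝ => (1 + t) ^ m) (m : ℝ) 0 := fun m => by
      have := ((hasDerivAt_id (0 : ℝ)).const_add 1).pow m
      refine this.congr_deriv ?_
      simp
    have h7 : HasDerivAt (fun t : ℝ => x ^ j * (((1 + t) ^ j : ℝ) : ℂ)) (x ^ j * (j : ℝ)) 0 :=
      (h6 j).ofReal_comp.const_mul (x ^ j)
    have h8 : HasDerivAt (fun t : ℝ => Φ j ((1 + t) ^ r * u)) ((r * u : ℝ) • deriv (Φ j) u) 0 := by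
      have h9 := SchwartzMap.hasDerivAt (Φ j) ((1 + 0) ^ r * u)
      have := HasDerivAt.scomp (0 : ℝ) h9 ((h6 r).mul_const u)
      refine this.congr_deriv ?_
      simp
    refine (h7.mul h8).congr_deriv ?_
    simp only [add_zero, one_pow, one_mul, Complex.ofReal_one, mul_one, Complex.real_smul]
    push_cast
    ring
  rw [RadialLines.alongDeriv, lineDeriv, h1.deriv_eq, h5.deriv]

/-- Let `E` and `O` be the even and odd parts of `Φ s`. The derivative of `x^s` produces `s (E +
O)`; the term `-s Π_s` cancels `s E`, and `Π_(r+s)` raises the coefficient of `O` to `2ν + 1 + 2s -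
r = 2 r ν_s`. -/
theorem HasComponents.dunklOp {r : ℕ} {f : ℂ → ℂ} {Φ : ℕ → 𝓢(ℝ, ℂ)} (h0 : r ≠ 0) (ν : ℝ)
    (hf : HasComponents r f Φ) :
    HasComponents r (dunklOp r ν f) fun j => dunkl (nuParam r ν j) (Φ j) := by
  intro x u hu hx
  have hr0 : (r : ℂ) ≠ 0 := by exact_mod_cast h0
  have hu0 : (u : ℂ) ≠ 0 := Complex.ofReal_ne_zero.2 hu
  have hx0 : x ≠ 0 := fun h => hu0 (by rw [← hx, h, zero_pow h0])
  have hxr : x ^ (r - 1) * x = u := by rw [← pow_succ, Nat.sub_add_cancel (by omega), hx]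
  have hA : ∀ s ∈ Finset.range r, ((2 * ν + 1 + s - r : ℝ) : ℂ) *
      RadialLines.reflProj r (r + s) f x - (s : ℂ) * RadialLines.reflProj r s f x =
      x ^ s * (((2 * ν + 1 + s - r : ℝ) : ℂ) * ((Φ s u - Φ s (-u)) / 2) -
        s * ((Φ s u + Φ s (-u)) / 2)) := by
    intro s hs
    have hs' := Finset.mem_range.1 hs
    rw [hf.reflProj h0 hu hx (show r + s < 2 * r by omega),
      hf.reflProj h0 hu hx (show s < 2 * r by omega), Finset.sum_eq_single_of_mem s hs,
      Finset.sum_eq_single_of_mem s hs]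
    · rw [if_neg (by omega), if_pos (by omega), if_pos rfl, if_neg (by omega)]
      ring
    · intro j hj hjs
      have := Finset.mem_range.1 hj
      rw [if_neg (by omega), if_neg (by omega)]
      ring
    · intro j hj hjs
      have := Finset.mem_range.1 hj
      rw [if_neg (by omega), if_neg (by omega)]
      ring
  rw [RadialLines.dunklOp, hf.alongDeriv hu hx, Finset.sum_congr rfl hA, hx]
  have hB : ∀ S : ℂ, 1 / (r * x ^ (r - 1)) * (S / x) = 1 / (r * u) * S := fun S => by
    have : x ^ (r - 1) ≠ 0 := pow_ne_zero _ hx0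
    rw [← hxr]
    field_simp
  rw [hB, ← mul_add, ← Finset.sum_add_distrib, Finset.mul_sum]
  refine Finset.sum_congr rfl fun s _ => ?_
  rw [dunkl_apply _ _ hu, nuParam]
  push_cast
  field_simp
  ring

theorem HasComponents.hamiltonianExpr {r : ℕ} {f : ℂ → ℂ} {Φ : ℕ → 𝓢(ℝ, ℂ)} (h0 : r ≠ 0) (ν : ℝ)
    (hf : HasComponents r f Φ) :
    HasComponents r (hamiltonianExpr r ν f) fun j => oscillator (nuParam r ν j) (Φ j) := by
  intro x u hu hx
  rw [RadialLines.hamiltonianExpr, (hf.dunklOp h0 ν).dunklOp h0 ν x u hu hx, hf x u hu hx,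
    mul_comm 2 r, pow_mul, hx, Finset.mul_sum, Finset.mul_sum, ← Finset.sum_add_distrib]
  refine Finset.sum_congr rfl fun s _ => ?_
  simp only [oscillator, add_apply, smul_apply, mulX_apply, smul_eq_mul]
  ring

theorem exists_pow_eq_of_odd {r : ℕ} (hr : Odd r) (u : ℝ) : ∃ t : ℝ, t ^ r = u := by
  rcases le_total 0 u with h | h
  · exact ⟨u ^ (r⁻¹ : ℝ), Real.rpow_inv_natCast_pow h hr.pos.ne'⟩
  · refine ⟨-(-u) ^ (r⁻¹ : ℝ), ?_⟩
    rw [hr.neg_pow, Real.rpow_inv_natCast_pow (neg_nonneg.2 h) hr.pos.ne', neg_neg]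

/-- An odd root of a real number can be taken real, so the points with `x^r` real and nonzero lie on
the `r` lines. -/
theorem exists_real_root {r : ℕ} (hr : Odd r) {x : ℂ} {u : ℝ} (hu : u ≠ 0) (hx : x ^ r = u) :
    ∃ k < r, ∃ t : ℝ, t ≠ 0 ∧ t ^ r = u ∧ x = omega r ^ k * t := by
  have h0 : r ≠ 0 := hr.pos.ne'
  obtain ⟨t, rfl⟩ := exists_pow_eq_of_odd hr u
  have ht : t ≠ 0 := fun h => hu (by simp [h, h0])
  have ht' : (t : ℂ) ≠ 0 := Complex.ofReal_ne_zero.2 ht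
  have h1 : (x / t) ^ r = 1 := by
    rw [div_pow, hx]
    push_cast
    exact div_self (pow_ne_zero _ ht')
  have : NeZero r := ⟨h0⟩
  obtain ⟨k, hk, h2⟩ := (isPrimitiveRoot_omega h0).eq_pow_of_pow_eq_one h1
  exact ⟨k, hk, t, ht, rfl, by rw [h2, div_mul_cancel₀ _ ht']⟩

/-- Fourier inversion over the rotations: the components on the real axis determine `f` on every
line. -/
theorem sum_omega_mul_sectorProj {r : ℕ} (h0 : r ≠ 0) (f : ℂ → ℂ) (x : ℂ) {k : ℕ} (hk : k < r) :
    ∑ j ∈ Finset.range r, omega r ^ (k * j) * sectorProj r j f x = f (omega r ^ k * x) := by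
  have hr0 : (r : ℂ) ≠ 0 := by exact_mod_cast h0
  simp only [sectorProj, Finset.mul_sum]
  rw [Finset.sum_comm, Finset.sum_eq_single_of_mem k (Finset.mem_range.2 hk)]
  · have h1 := sum_inv_mul_pow (isPrimitiveRoot_omega h0) hk hk
    rw [if_pos rfl] at h1
    have h2 : ∀ j, omega r ^ (k * j) * (1 / (r : ℂ) * ((omega r ^ (j * k))⁻¹ *
        f (omega r ^ k * x))) = 1 / (r : ℂ) * f (omega r ^ k * x) *
          ((omega r ^ (k * j))⁻¹ * omega r ^ (k * j)) := fun j => by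
      rw [mul_comm j k]
      ring
    simp only [h2, ← Finset.mul_sum, h1]
    field_simp
  · intro l hl hlk
    have h1 := sum_inv_mul_pow (isPrimitiveRoot_omega h0) (Finset.mem_range.1 hl) hk
    rw [if_neg hlk] at h1
    have h2 : ∀ j, omega r ^ (k * j) * (1 / (r : ℂ) * ((omega r ^ (j * l))⁻¹ *
        f (omega r ^ l * x))) = 1 / (r : ℂ) * f (omega r ^ l * x) *
          ((omega r ^ (l * j))⁻¹ * omega r ^ (k * j)) := fun j => by
      rw [mul_comm j l]
      ring
    simp only [h2, ← Finset.mul_sum, h1, mul_zero]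

theorem exists_hasComponents {r : ℕ} (hr : Odd r) {f : ℂ → ℂ} (hf : f ∈ schwartzSpace r) :
    ∃ Φ, HasComponents r f Φ := by
  have h0 : r ≠ 0 := hr.pos.ne'
  have hf' : ∀ j, ∃ φ : 𝓢(ℝ, ℂ), j < r → ∀ t : ℝ, sectorProj r j f t = (t : ℂ) ^ j * φ (t ^ r) := by
    intro j
    by_cases hj : j < r
    · obtain ⟨φ, hφ⟩ := hf j hj
      exact ⟨φ, fun _ => hφ⟩
    · exact ⟨0, fun h => absurd h hj⟩
  choose Φ hΦ using hf'
  refine ⟨Φ, fun x u hu hx => ?_⟩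
  obtain ⟨k, hk, t, ht, rfl, rfl⟩ := exists_real_root hr hu hx
  rw [← sum_omega_mul_sectorProj h0 f t hk]
  refine Finset.sum_congr rfl fun j hj => ?_
  rw [hΦ j (Finset.mem_range.1 hj), mul_pow, pow_mul]
  ring

/-- The coefficients `c` stand for `Φ l (t ^ r)`, which are constant along the orbit of `t` under
`ω`. Fixing the orbit lets the lemma serve with or without the origin. -/
theorem sectorProj_eq_of_eq_sum {r : ℕ} (h0 : r ≠ 0) {f : ℂ → ℂ} (x : ℂ) (c : ℕ → ℂ)
    (hf : ∀ k, f (omega r ^ k * x) = ∑ l ∈ Finset.range r, (omega r ^ k * x) ^ l * c l) {j : ℕ}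
    (hj : j < r) : sectorProj r j f x = x ^ j * c j := by
  have hr0 : (r : ℂ) ≠ 0 := by exact_mod_cast h0
  have h1 : ∀ k, f (omega r ^ k * x) =
      ∑ l ∈ Finset.range r, omega r ^ (l * k) * (x ^ l * c l) := by
    intro k
    rw [hf]
    refine Finset.sum_congr rfl fun l _ => ?_
    rw [mul_pow, ← pow_mul, mul_comm k]
    ring
  have h3 : ∀ l k, 1 / (r : ℂ) * ((omega r ^ (j * k))⁻¹ * (omega r ^ (l * k) * (x ^ l * c l))) =
      1 / (r : ℂ) * (x ^ l * c l) * ((omega r ^ (j * k))⁻¹ * omega r ^ (l * k)) :=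
    fun l k => by ring
  simp only [sectorProj, h1, Finset.mul_sum]
  rw [Finset.sum_comm, Finset.sum_eq_single_of_mem j (Finset.mem_range.2 hj)]
  · have h2 := sum_inv_mul_pow (isPrimitiveRoot_omega h0) hj hj
    rw [if_pos rfl] at h2
    simp only [h3, ← Finset.mul_sum, h2]
    field_simp
  · intro l hl hlj
    have h2 := sum_inv_mul_pow (isPrimitiveRoot_omega h0) hj (Finset.mem_range.1 hl)
    rw [if_neg (Ne.symm hlj)] at h2
    simp only [h3, ← Finset.mul_sum, h2, mul_zero]

theorem omega_pow_mul_pow {r : ℕ} (h0 : r ≠ 0) (k : ℕ) (t : ℝ) :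
    (omega r ^ k * (t : ℂ)) ^ r = ((t ^ r : ℝ) : ℂ) := by
  rw [mul_pow, ← pow_mul, mul_comm k, pow_mul, (isPrimitiveRoot_omega h0).pow_eq_one]
  simp

theorem HasComponents.sectorProj {r : ℕ} (h0 : r ≠ 0) {f : ℂ → ℂ} {Φ : ℕ → 𝓢(ℝ, ℂ)}
    (hf : HasComponents r f Φ) {t : ℝ} (ht : t ≠ 0) {j : ℕ} (hj : j < r) :
    sectorProj r j f t = (t : ℂ) ^ j * Φ j (t ^ r) :=
  sectorProj_eq_of_eq_sum h0 t (fun l => Φ l (t ^ r))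
    (fun k => hf _ _ (pow_ne_zero _ ht) (omega_pow_mul_pow h0 k t)) hj

theorem mem_schwartzSpace_of_eq_sum {r : ℕ} (h0 : r ≠ 0) {f : ℂ → ℂ} (Φ : ℕ → 𝓢(ℝ, ℂ))
    (hf : ∀ (x : ℂ) (u : ℝ), x ^ r = u → f x = ∑ j ∈ Finset.range r, x ^ j * Φ j u) :
    f ∈ schwartzSpace r := fun j hj =>
  ⟨Φ j, fun t => sectorProj_eq_of_eq_sum h0 t (fun l => Φ l (t ^ r))
    (fun k => hf _ _ (omega_pow_mul_pow h0 k t)) hj⟩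

/-- The components of the Hermite functions. -/
noncomputable def hermiteComponents (r : ℕ) (ν : ℝ) (N j : ℕ) : 𝓢(ℝ, ℂ) :=
  if j = N % r then ((1 / Real.sqrt (hermiteNormSq r ν N) : ℝ) : ℂ) •
    hermiteLadder (nuParam r ν (N % r)) (N / r) else 0

theorem hermiteFunction_eq (r : ℕ) (ν : ℝ) (N : ℕ) {x : ℂ} {u : ℝ} (hx : x ^ r = u) :
    hermiteFunction r ν N x = ((1 / Real.sqrt (hermiteNormSq r ν N) : ℝ) : ℂ) *
      (x ^ (N % r) * hermiteLadder (nuParam r ν (N % r)) (N / r) u) := by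
  have h1 : Complex.exp (-x ^ (2 * r) / 2) = ((Real.exp (-(u ^ 2 / 2)) : ℝ) : ℂ) := by
    rw [mul_comm 2 r, pow_mul, hx]
    push_cast
    congr 1
    ring
  have h2 : Polynomial.aeval x (radialHermite r ν N) = x ^ (N % r) *
      (((genHermite (nuParam r ν (N % r)) (N / r)).eval u : ℝ) : ℂ) := by
    rw [radialHermite, map_mul, map_pow, Polynomial.aeval_X, Polynomial.aeval_comp, map_pow,
      Polynomial.aeval_X, hx]
    congr 1
    exact Polynomial.aeval_algebraMap_apply_eq_algebraMap_eval u _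
  rw [hermiteFunction, h1, h2, hermiteLadder_apply]
  push_cast
  ring

theorem hermiteFunction_eq_sum {r : ℕ} (h0 : r ≠ 0) (ν : ℝ) (N : ℕ) {x : ℂ} {u : ℝ}
    (hx : x ^ r = u) : hermiteFunction r ν N x =
      ∑ j ∈ Finset.range r, x ^ j * hermiteComponents r ν N j u := by
  rw [hermiteFunction_eq r ν N hx, Finset.sum_eq_single_of_mem (N % r)
    (Finset.mem_range.2 (Nat.mod_lt _ (Nat.pos_of_ne_zero h0)))]
  · rw [hermiteComponents, if_pos rfl, smul_apply, smul_eq_mul]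
    ring
  · intro j _ hj
    rw [hermiteComponents, if_neg hj, zero_apply, mul_zero]

theorem hasComponents_hermiteFunction {r : ℕ} (h0 : r ≠ 0) (ν : ℝ) (N : ℕ) :
    HasComponents r (hermiteFunction r ν N) (hermiteComponents r ν N) :=
  fun _ _ _ hx => hermiteFunction_eq_sum h0 ν N hx

theorem hermiteFunction_mem_schwartzSpace {r : ℕ} (h0 : r ≠ 0) (ν : ℝ) (N : ℕ) :
    hermiteFunction r ν N ∈ schwartzSpace r :=
  mem_schwartzSpace_of_eq_sum h0 _ fun _ _ hx => hermiteFunction_eq_sum h0 ν N hx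

end RadialLines

/-! ### Integration over the lines -/

namespace SchwartzMap

/-- The Schwartz function `t ↦ t ^ j * φ (t ^ r)`. -/
theorem exists_pow_mul_comp_pow {r : ℕ} (h0 : r ≠ 0) (j : ℕ) (φ : 𝓢(ℝ, ℂ)) :
    ∃ ψ : 𝓢(ℝ, ℂ), ∀ t : ℝ, ψ t = (t : ℂ) ^ j * φ (t ^ r) := by
  have h1 : Function.HasTemperateGrowth fun t : ℝ => t ^ r :=
    Function.HasTemperateGrowth.pow Function.HasTemperateGrowth.id' r
  -- Decay survives the composition because `|t| ≤ 1 + |t^r|`.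
  have h2 : ∃ (k : ℕ) (C : ℝ), ∀ t : ℝ, ‖t‖ ≤ C * (1 + ‖t ^ r‖) ^ k := by
    refine ⟨1, 1, fun t => ?_⟩
    rw [pow_one, one_mul, norm_pow]
    rcases le_total ‖t‖ 1 with h | h
    · have : 0 ≤ ‖t‖ ^ r := by positivity
      linarith
    · have := le_self_pow₀ h h0
      linarith
  have h3 : Function.HasTemperateGrowth fun t : ℝ => (t : ℂ) ^ j := hasTemperateGrowth_ofReal'.pow j
  refine ⟨smulLeftCLM ℂ (fun t : ℝ => (t : ℂ) ^ j) (compCLM ℂ h1 h2 φ), fun t => ?_⟩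
  rw [smulLeftCLM_apply_apply h3]
  rfl

end SchwartzMap

namespace RadialLines

open SchwartzMap

/-- The substitution `u = t^r` on the half-line, with `2ν + 2j = (r - 1) + 2 r ν_j`. Oddness of `r`
matches `-t` with `-u`. -/
theorem integral_weightMeasure_comp_pow {r : ℕ} (h0 : r ≠ 0) {ν : ℝ} (hν : 0 < ν) {j : ℕ}
    (hj : 0 < nuParam r ν j) (hr : Odd r) (φ : 𝓢(ℝ, ℂ)) :
    ∫ t, (t : ℂ) ^ (2 * j) * φ (t ^ r) ∂weightMeasure ν =
      (1 / (r : ℂ)) * ∫ u, φ u ∂weightMeasure (nuParam r ν j) := by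
  have hr0 : (0 : ℝ) < r := by exact_mod_cast Nat.pos_of_ne_zero h0
  have hr0' : (r : ℂ) ≠ 0 := by exact_mod_cast h0
  obtain ⟨ψ, hψ⟩ := exists_pow_mul_comp_pow h0 (2 * j) φ
  have h1 : ∫ t, (t : ℂ) ^ (2 * j) * φ (t ^ r) ∂weightMeasure ν = ∫ t, ψ t ∂weightMeasure ν := by
    simp only [hψ]
  rw [h1, integral_weightMeasure_eq_Ioi ν (ψ.integrable_weight hν),
    integral_weightMeasure_eq_Ioi _ (φ.integrable_weight hj),
    ← integral_comp_rpow_Ioi_of_pos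
      (g := fun u : ℝ => u ^ (2 * nuParam r ν j) • (φ u + φ (-u))) hr0,
    ← integral_const_mul]
  refine setIntegral_congr_fun measurableSet_Ioi fun t ht => ?_
  have ht' : 0 < t := ht
  have h2 : (t ^ (2 * ν) : ℝ) * t ^ (2 * j) =
      t ^ ((r : ℝ) - 1) * (t ^ (r : ℝ)) ^ (2 * nuParam r ν j) := by
    rw [← Real.rpow_natCast t (2 * j), ← Real.rpow_add ht', ← Real.rpow_mul ht'.le,
      ← Real.rpow_add ht']
    congr 1
    rw [nuParam]
    push_cast
    field_simp
    ring
  have h3 : ((t ^ (2 * ν) : ℝ) : ℂ) * (t : ℂ) ^ (2 * j) =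
      ((t ^ ((r : ℝ) - 1) : ℝ) : ℂ) * (((t ^ (r : ℝ)) ^ (2 * nuParam r ν j) : ℝ) : ℂ) := by
    exact_mod_cast h2
  simp only [hψ, hr.neg_pow, Complex.real_smul, Complex.ofReal_neg, (even_two_mul j).neg_pow]
  rw [← mul_add, ← mul_assoc, h3, Real.rpow_natCast]
  push_cast
  field_simp

theorem measurableEmbedding_line {r : ℕ} (h0 : r ≠ 0) (k : ℕ) :
    MeasurableEmbedding fun t : ℝ => omega r ^ k * (t : ℂ) := by
  refine Continuous.measurableEmbedding (by fun_prop) fun s t h => ?_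
  have hω : omega r ^ k ≠ 0 := pow_ne_zero _ ((isPrimitiveRoot_omega h0).ne_zero h0)
  exact Complex.ofReal_injective (mul_left_cancel₀ hω h)

theorem lineMeasure_eq (r : ℕ) (ν : ℝ) : lineMeasure r ν =
    ∑ k ∈ Finset.range r, (weightMeasure ν).map fun t : ℝ => omega r ^ k * (t : ℂ) := rfl

theorem ae_lineMeasure_iff {r : ℕ} (h0 : r ≠ 0) (ν : ℝ) {p : ℂ → Prop} :
    (∀ᵐ x ∂lineMeasure r ν, p x) ↔
      ∀ k < r, ∀ᵐ t : ℝ ∂weightMeasure ν, p (omega r ^ k * (t : ℂ)) := by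
  rw [lineMeasure_eq, ae_finsetSum_measure_iff]
  simp only [Finset.mem_range, (measurableEmbedding_line h0 _).ae_map_iff]

theorem aestronglyMeasurable_finsetSum_measure {α ι : Type*} [MeasurableSpace α] {f : α → ℂ}
    {s : Finset ι} {m : ι → Measure α} (h : ∀ i ∈ s, AEStronglyMeasurable f (m i)) :
    AEStronglyMeasurable f (∑ i ∈ s, m i) := by
  classical
  induction s using Finset.induction_on with
  | empty => simp
  | insert i s hi ih =>
    rw [Finset.sum_insert hi, aestronglyMeasurable_add_measure_iff]
    exact ⟨h i (Finset.mem_insert_self _ _), ih fun j hj => h j (Finset.mem_insert_of_mem hj)⟩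

theorem integrable_lineMeasure_iff {r : ℕ} (h0 : r ≠ 0) (ν : ℝ) {E : Type*} [NormedAddCommGroup E]
    {f : ℂ → E} : Integrable f (lineMeasure r ν) ↔
      ∀ k < r, Integrable (fun t : ℝ => f (omega r ^ k * (t : ℂ))) (weightMeasure ν) := by
  rw [lineMeasure_eq, integrable_finsetSum_measure]
  simp only [Finset.mem_range, (measurableEmbedding_line h0 _).integrable_map_iff]
  rfl

theorem integral_lineMeasure {r : ℕ} (h0 : r ≠ 0) (ν : ℝ) {f : ℂ → ℂ}
    (hf : Integrable f (lineMeasure r ν)) : ∫ x, f x ∂lineMeasure r ν =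
      ∑ k ∈ Finset.range r, ∫ t : ℝ, f (omega r ^ k * (t : ℂ)) ∂weightMeasure ν := by
  rw [lineMeasure_eq, integrable_finsetSum_measure] at hf
  rw [lineMeasure_eq, integral_finsetSum_measure hf]
  simp only [(measurableEmbedding_line h0 _).integral_map]

theorem memLp_lineMeasure_iff {r : ℕ} (h0 : r ≠ 0) (ν : ℝ) {f : ℂ → ℂ} :
    MemLp f 2 (lineMeasure r ν) ↔
      ∀ k < r, MemLp (fun t : ℝ => f (omega r ^ k * (t : ℂ))) 2 (weightMeasure ν) := by
  constructor
  · intro h k hk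
    have h1 : AEStronglyMeasurable (fun t : ℝ => f (omega r ^ k * (t : ℂ))) (weightMeasure ν) := by
      refine (measurableEmbedding_line h0 k).aestronglyMeasurable_map_iff.1
        (h.1.mono_measure ?_)
      rw [lineMeasure_eq]
      exact Finset.single_le_sum
        (f := fun k => (weightMeasure ν).map fun t : ℝ => omega r ^ k * (t : ℂ))
        (fun _ _ => Measure.zero_le _) (Finset.mem_range.2 hk)
    rw [memLp_two_iff_integrable_sq_norm h1]
    have h2 := (memLp_two_iff_integrable_sq_norm h.1).1 h
    exact (integrable_lineMeasure_iff h0 ν).1 h2 k hk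
  · intro h
    have h1 : AEStronglyMeasurable f (lineMeasure r ν) :=
      aestronglyMeasurable_finsetSum_measure fun k hk =>
        (measurableEmbedding_line h0 k).aestronglyMeasurable_map_iff.2
          (h k (Finset.mem_range.1 hk)).1
    rw [memLp_two_iff_integrable_sq_norm h1, integrable_lineMeasure_iff h0]
    exact fun k hk => (memLp_two_iff_integrable_sq_norm (h k hk).1).1 (h k hk)

theorem HasComponents.memLp {r : ℕ} (h0 : r ≠ 0) {ν : ℝ} (hν : 0 < ν) {f : ℂ → ℂ}
    {Φ : ℕ → 𝓢(ℝ, ℂ)} (hf : HasComponents r f Φ) : MemLp f 2 (lineMeasure r ν) := by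
  rw [memLp_lineMeasure_iff h0]
  intro k _
  choose Ψ hΨ using fun j => exists_pow_mul_comp_pow h0 j (Φ j)
  refine ((∑ j ∈ Finset.range r, omega r ^ (k * j) • Ψ j).memLp_weight hν).ae_eq ?_
  filter_upwards [ae_weightMeasure_ne_zero ν] with t ht
  rw [hf _ _ (pow_ne_zero _ ht) (omega_pow_mul_pow h0 k t)]
  have h1 : (∑ j ∈ Finset.range r, omega r ^ (k * j) • Ψ j) t =
      ∑ j ∈ Finset.range r, (omega r ^ (k * j) • Ψ j) t := by
    simp
  rw [h1]
  refine Finset.sum_congr rfl fun j _ => ?_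
  rw [smul_apply, hΨ, smul_eq_mul, mul_pow, pow_mul]
  ring

theorem memLp_hermiteFunction {r : ℕ} (h0 : r ≠ 0) {ν : ℝ} (hν : 0 < ν) (N : ℕ) :
    MemLp (hermiteFunction r ν N) 2 (lineMeasure r ν) :=
  (hasComponents_hermiteFunction h0 ν N).memLp h0 hν

theorem memLp_sectorProj {r : ℕ} (h0 : r ≠ 0) {ν : ℝ} {f : ℂ → ℂ}
    (hf : MemLp f 2 (lineMeasure r ν)) (j : ℕ) :
    MemLp (fun t : ℝ => sectorProj r j f t) 2 (weightMeasure ν) := by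
  rw [memLp_lineMeasure_iff h0] at hf
  simp only [sectorProj]
  refine MemLp.const_mul ?_ _
  exact memLp_finsetSum _ fun k hk => (hf k (Finset.mem_range.1 hk)).const_mul _

theorem conj_omega {r : ℕ} (h0 : r ≠ 0) (k : ℕ) :
    (starRingEnd ℂ) (omega r ^ k) = (omega r ^ k)⁻¹ := by
  have h1 : ‖omega r ^ k‖ = 1 := by
    rw [norm_pow, (isPrimitiveRoot_omega h0).norm'_eq_one h0, one_pow]
  rw [Complex.inv_def, Complex.normSq_eq_norm_sq, h1]
  simp

/-- The normalizing constant of the Hermite function. -/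
noncomputable def hermiteConst (r : ℕ) (ν : ℝ) (N : ℕ) : ℝ := 1 / Real.sqrt (hermiteNormSq r ν N)

theorem conj_hermiteFunction {r : ℕ} (h0 : r ≠ 0) (ν : ℝ) (N k : ℕ) (t : ℝ) :
    (starRingEnd ℂ) (hermiteFunction r ν N (omega r ^ k * t)) =
      (hermiteConst r ν N : ℂ) * ((omega r ^ (N % r * k))⁻¹ *
        ((t : ℂ) ^ (N % r) * hermiteLadder (nuParam r ν (N % r)) (N / r) (t ^ r))) := by
  rw [hermiteFunction_eq r ν N (omega_pow_mul_pow h0 k t), hermiteLadder_apply, mul_pow, ← pow_mul,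
    mul_comm k]
  simp only [map_mul, Complex.conj_ofReal, conj_omega h0, map_pow, hermiteConst]
  ring

/-- The inner products with the Hermite functions, reduced to the line. -/
theorem integral_conj_hermiteFunction_mul {r : ℕ} (h0 : r ≠ 0) {ν : ℝ} (hν : 0 < ν) (N : ℕ)
    {F : ℂ → ℂ} (hF : MemLp F 2 (lineMeasure r ν)) :
    ∫ x, (starRingEnd ℂ) (hermiteFunction r ν N x) * F x ∂lineMeasure r ν =
      (hermiteConst r ν N : ℂ) * (r * ∫ t : ℝ, (t : ℂ) ^ (N % r) *
        hermiteLadder (nuParam r ν (N % r)) (N / r) (t ^ r) * sectorProj r (N % r) F t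
          ∂weightMeasure ν) := by
  have hr0 : (r : ℂ) ≠ 0 := by exact_mod_cast h0
  have hint : Integrable (fun x => (starRingEnd ℂ) (hermiteFunction r ν N x) * F x)
      (lineMeasure r ν) := (memLp_hermiteFunction h0 hν N).star.integrable_mul hF
  rw [integral_lineMeasure h0 ν hint, ← integral_finsetSum _ fun k hk =>
    (integrable_lineMeasure_iff h0 ν).1 hint k (Finset.mem_range.1 hk), ← integral_const_mul,
    ← integral_const_mul]
  congr 1
  ext t
  -- Conjugation inverts the roots of unity, so the sum over the lines is `r` times the sector
  -- projection.
  simp only [conj_hermiteFunction h0, sectorProj, Finset.mul_sum]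
  refine Finset.sum_congr rfl fun k _ => ?_
  field_simp

/-- The factor `r` from the number of lines cancels the `1 / r` of the substitution `u = t^r`. -/
theorem integral_conj_hermiteFunction_mul_of_hasComponents {r : ℕ} (hr : Odd r) {ν : ℝ}
    (hν : 0 < ν) (N : ℕ) (hN : 0 < nuParam r ν (N % r)) {F : ℂ → ℂ} {Φ : ℕ → 𝓢(ℝ, ℂ)}
    (hF : HasComponents r F Φ) :
    ∫ x, (starRingEnd ℂ) (hermiteFunction r ν N x) * F x ∂lineMeasure r ν =
      (hermiteConst r ν N : ℂ) * weightedPairing (nuParam r ν (N % r))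
        (hermiteLadder (nuParam r ν (N % r)) (N / r)) (Φ (N % r)) := by
  have h0 : r ≠ 0 := hr.pos.ne'
  have hr0 : (r : ℂ) ≠ 0 := by exact_mod_cast h0
  rw [integral_conj_hermiteFunction_mul h0 hν N (hF.memLp h0 hν)]
  congr 1
  set ψ := hermiteLadder (nuParam r ν (N % r)) (N / r)
  have h1 : ∫ t : ℝ, (t : ℂ) ^ (N % r) * ψ (t ^ r) * sectorProj r (N % r) F t ∂weightMeasure ν =
      ∫ t : ℝ, (t : ℂ) ^ (2 * (N % r)) * (product ψ (Φ (N % r))) (t ^ r) ∂weightMeasure ν := by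
    refine integral_congr_ae ?_
    filter_upwards [ae_weightMeasure_ne_zero ν] with t ht
    rw [hF.sectorProj h0 ht (Nat.mod_lt _ hr.pos), product_apply]
    ring
  rw [h1, integral_weightMeasure_comp_pow h0 hν hN hr, weightedPairing]
  simp only [product_apply]
  field_simp

end RadialLines

/-! ### Moments and completeness -/

/-- A real function on the line is determined by its moments with respect to an injective
function, if all exponential moments exist. -/
theorem ae_eq_zero_of_moments_real {m : Measure ℝ} {v K : ℝ → ℝ} (hv : MeasurableEmbedding v)
    (hint : ∀ c : ℝ, Integrable (fun t => Real.exp (c * |v t|) * K t) m)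
    (hmom : ∀ n : ℕ, ∫ t, v t ^ n * K t ∂m = 0) : K =ᵐ[m] 0 := by
  have hK : Integrable K m := by simpa using hint 0
  -- Termwise integration of the exponential series, dominated by `exp (|ξ| |v|) |K|`.
  have hexp : ∀ ξ : ℝ, ∫ t, Complex.exp (ξ * v t * Complex.I) * K t ∂m = 0 := by
    intro ξ
    have hsum := hasSum_integral_of_dominated_convergence (μ := m)
      (F := fun (n : ℕ) t => ((ξ : ℂ) * v t * Complex.I) ^ n / n.factorial * K t)
      (f := fun t => Complex.exp (ξ * v t * Complex.I) * K t)
      (fun n t => (|ξ| * |v t|) ^ n / n.factorial * ‖K t‖) ?_ ?_ ?_ ?_ ?_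
    · have h0 : ∀ n : ℕ, ∫ t, ((ξ : ℂ) * v t * Complex.I) ^ n / n.factorial * K t ∂m = 0 := by
        intro n
        have h1 : ∀ t, ((ξ : ℂ) * v t * Complex.I) ^ n / n.factorial * K t =
            (ξ * Complex.I) ^ n / n.factorial * ((v t ^ n * K t : ℝ) : ℂ) := fun t => by
          push_cast
          ring
        simp only [h1]
        rw [integral_const_mul, integral_complex_ofReal, hmom]
        simp
      simp only [h0] at hsum
      exact hsum.unique hasSum_zero
    · intro n
      refine AEStronglyMeasurable.mul ?_ (Complex.continuous_ofReal.comp_aestronglyMeasurable hK.1)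
      refine Measurable.aestronglyMeasurable ?_
      have := hv.measurable
      fun_prop
    · intro n
      refine Eventually.of_forall fun t => le_of_eq ?_
      rw [norm_mul, norm_div, norm_pow, norm_mul, norm_mul, Complex.norm_I, mul_one,
        Complex.norm_real, Complex.norm_real, Complex.norm_real, Complex.norm_natCast]
      rfl
    · exact Eventually.of_forall fun t => (Real.summable_pow_div_factorial _).mul_right _
    · have h1 : ∀ t, ∑' n : ℕ, (|ξ| * |v t|) ^ n / n.factorial * ‖K t‖ =
          ‖Real.exp (|ξ| * |v t|) * K t‖ := fun t => by
        rw [tsum_mul_right, norm_mul, Real.norm_of_nonneg (Real.exp_pos _).le, Real.exp_eq_exp_ℝ,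
          NormedSpace.exp_eq_tsum_div]
      simp only [h1]
      exact (hint |ξ|).norm
    · refine Eventually.of_forall fun t => HasSum.mul_right _ ?_
      rw [Complex.exp_eq_exp_ℂ]
      exact NormedSpace.expSeries_div_hasSum_exp _
  have hpos : ∀ K : ℝ → ℝ, Integrable K m → ∀ ξ : ℝ,
      charFun ((m.withDensity fun t => ENNReal.ofReal (K t)).map v) ξ =
        ∫ t, Complex.exp (ξ * v t * Complex.I) * ((max (K t) 0 : ℝ) : ℂ) ∂m := by
    intro K hK ξ
    rw [charFun_apply_real, hv.integral_map, integral_withDensity_eq_integral_toReal_smul₀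
      hK.1.aemeasurable.ennreal_ofReal (Eventually.of_forall fun _ => ENNReal.ofReal_lt_top)]
    refine integral_congr_ae (Eventually.of_forall fun t => ?_)
    simp only
    rw [ENNReal.toReal_ofReal', Complex.real_smul, mul_comm]
  have hfin : ∀ K : ℝ → ℝ, Integrable K m →
      IsFiniteMeasure (m.withDensity fun t => ENNReal.ofReal (K t)) := fun K hK =>
    isFiniteMeasure_withDensity_ofReal hK.2
  have hintexp : ∀ (ξ : ℝ) (K : ℝ → ℝ), Integrable K m → Integrable (fun t =>
      Complex.exp (ξ * v t * Complex.I) * ((max (K t) 0 : ℝ) : ℂ)) m := by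
    intro ξ K hK
    refine (hK.pos_part.ofReal (𝕜 := ℂ)).bdd_mul (c := 1) ?_ (Eventually.of_forall fun t => ?_)
    · refine Measurable.aestronglyMeasurable ?_
      have := hv.measurable
      fun_prop
    · rw [← Complex.ofReal_mul, Complex.norm_exp_ofReal_mul_I]
  -- The positive and negative parts of `K` give finite measures whose images under `v` have the
  -- same characteristic function.
  have hmap : (m.withDensity fun t => ENNReal.ofReal (K t)).map v =
      (m.withDensity fun t => ENNReal.ofReal (-K t)).map v := by
    have := hfin K hK
    have := hfin (fun t => -K t) hK.neg
    refine Measure.ext_of_charFun (funext fun ξ => ?_)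
    rw [hpos K hK, hpos (fun t => -K t) hK.neg, ← sub_eq_zero,
      ← integral_sub (hintexp ξ K hK) (hintexp ξ (fun t => -K t) hK.neg), ← hexp ξ]
    refine integral_congr_ae (Eventually.of_forall fun t => ?_)
    simp only
    rw [← mul_sub, ← Complex.ofReal_sub]
    congr 2
    rcases le_total (K t) 0 with h | h
    · rw [max_eq_right h, max_eq_left (by linarith)]
      ring
    · rw [max_eq_left h, max_eq_right (by linarith)]
      ring
  have heq := hv.map_injective hmap
  have hfin' : ∫⁻ t, ENNReal.ofReal (K t) ∂m ≠ ⊤ := by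
    have := hfin K hK
    have h1 := measure_ne_top (m.withDensity fun t => ENNReal.ofReal (K t)) univ
    rwa [withDensity_apply _ MeasurableSet.univ, Measure.restrict_univ] at h1
  replace heq := (withDensity_eq_iff (g := fun t => ENNReal.ofReal (-K t))
    hK.1.aemeasurable.ennreal_ofReal hK.neg.1.aemeasurable.ennreal_ofReal hfin').1 heq
  filter_upwards [heq] with t ht
  rcases le_total (K t) 0 with h | h
  · rw [ENNReal.ofReal_of_nonpos h, eq_comm, ENNReal.ofReal_eq_zero] at ht
    exact le_antisymm h (neg_nonpos.1 ht)
  · rw [ENNReal.ofReal_of_nonpos (show -K t ≤ 0 by linarith), ENNReal.ofReal_eq_zero] at ht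
    exact le_antisymm ht h

/-- The complex version of `ae_eq_zero_of_moments_real`. -/
theorem ae_eq_zero_of_moments {m : Measure ℝ} {v : ℝ → ℝ} {K : ℝ → ℂ} (hv : MeasurableEmbedding v)
    (hint : ∀ c : ℝ, Integrable (fun t => (Real.exp (c * |v t|) : ℂ) * K t) m)
    (hmom : ∀ n : ℕ, ∫ t, (v t : ℂ) ^ n * K t ∂m = 0) : K =ᵐ[m] 0 := by
  have hint' : ∀ n : ℕ, Integrable (fun t => (v t : ℂ) ^ n * K t) m := by
    intro n
    refine ((hint 1).const_mul (n.factorial : ℂ)).mono ?_ (Eventually.of_forall fun t => ?_)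
    · have hK : Integrable K m := by simpa using hint 0
      refine AEStronglyMeasurable.mul ?_ hK.1
      refine Measurable.aestronglyMeasurable ?_
      have := hv.measurable
      fun_prop
    · have h1 := Real.pow_div_factorial_le_exp (x := |v t|) (abs_nonneg _) n
      have hf : (0 : ℝ) < n.factorial := by exact_mod_cast n.factorial_pos
      rw [div_le_iff₀ hf] at h1
      rw [norm_mul, norm_mul, norm_mul, norm_pow, Complex.norm_real, Complex.norm_real,
        Complex.norm_natCast, Real.norm_eq_abs, one_mul, Real.norm_of_nonneg (Real.exp_pos _).le,
        ← mul_assoc, mul_comm (n.factorial : ℝ)]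
      exact mul_le_mul_of_nonneg_right h1 (norm_nonneg _)
  have hre : (fun t => (K t).re) =ᵐ[m] 0 := by
    refine ae_eq_zero_of_moments_real hv (fun c => ?_) fun n => ?_
    · refine (hint c).re.congr (Eventually.of_forall fun t => ?_)
      simp only [RCLike.re_to_complex, Complex.re_ofReal_mul]
    · have h1 := integral_re (hint' n)
      rw [hmom n] at h1
      simp only [RCLike.re_to_complex, ← Complex.ofReal_pow, Complex.re_ofReal_mul,
        Complex.zero_re] at h1
      exact h1
  have him : (fun t => (K t).im) =ᵐ[m] 0 := by
    refine ae_eq_zero_of_moments_real hv (fun c => ?_) fun n => ?_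
    · refine (hint c).im.congr (Eventually.of_forall fun t => ?_)
      simp only [RCLike.im_to_complex, Complex.im_ofReal_mul]
    · have h1 := integral_im (hint' n)
      rw [hmom n] at h1
      simp only [RCLike.im_to_complex, ← Complex.ofReal_pow, Complex.im_ofReal_mul,
        Complex.zero_im] at h1
      exact h1
  filter_upwards [hre, him] with t h1 h2
  exact Complex.ext h1 h2

namespace SchwartzMap

/-- `x` is half the sum of `x - D` and `x + D`, both of which preserve the span of the ladder. -/
theorem mulX_iterate_mem_span (μ : ℝ) (n : ℕ) :
    mulX^[n] complexGaussian ∈ Submodule.span ℂ (range (hermiteLadder μ)) := by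
  have hmem : ∀ n, hermiteLadder μ n ∈ Submodule.span ℂ (range (hermiteLadder μ)) := fun n =>
    Submodule.subset_span ⟨n, rfl⟩
  have hle : Submodule.span ℂ (range (hermiteLadder μ)) ≤
      (Submodule.span ℂ (range (hermiteLadder μ))).comap
        (mulX : 𝓢(ℝ, ℂ) →L[ℂ] 𝓢(ℝ, ℂ)).toLinearMap := by
    rw [Submodule.span_le]
    rintro _ ⟨n, rfl⟩
    have h1 : mulX (hermiteLadder μ n) = (1 / 2 : ℂ) • hermiteLadder μ (n + 1) +
        (1 / 2 : ℂ) • (mulX (hermiteLadder μ n) + dunkl μ (hermiteLadder μ n)) := by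
      rw [hermiteLadder]
      ext x
      simp
      ring
    have h2 : mulX (hermiteLadder μ n) + dunkl μ (hermiteLadder μ n) ∈
        Submodule.span ℂ (range (hermiteLadder μ)) := by
      cases n with
      | zero =>
        rw [lower_hermiteLadder_zero]
        exact Submodule.zero_mem _
      | succ n =>
        rw [lower_hermiteLadder_succ]
        exact Submodule.smul_mem _ _ (hmem n)
    change mulX (hermiteLadder μ n) ∈ Submodule.span ℂ (range (hermiteLadder μ))
    rw [h1]
    exact Submodule.add_mem _ (Submodule.smul_mem _ _ (hmem _)) (Submodule.smul_mem _ _ h2)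
  induction n with
  | zero => exact hmem 0
  | succ n ih =>
    rw [Function.iterate_succ_apply']
    exact hle ih

theorem mulX_iterate_apply (φ : 𝓢(ℝ, ℂ)) (n : ℕ) (x : ℝ) : (mulX^[n] φ) x = (x : ℂ) ^ n * φ x := by
  induction n with
  | zero => simp
  | succ n ih =>
    rw [Function.iterate_succ_apply', mulX_apply, ih]
    ring

end SchwartzMap

namespace RadialLines

open SchwartzMap

theorem measurableEmbedding_pow {r : ℕ} (hr : Odd r) : MeasurableEmbedding fun t : ℝ => t ^ r :=
  Continuous.measurableEmbedding (by fun_prop) hr.strictMono_pow.injective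

/-- The Gaussian of width `√2`, as the square root of the Gaussian. -/
theorem exists_schwartz_exp_quarter :
    ∃ φ : 𝓢(ℝ, ℂ), ∀ u : ℝ, φ u = (Real.exp (-(u ^ 2 / 4)) : ℝ) := by
  have hs : (Real.sqrt 2)⁻¹ ≠ 0 := by positivity
  refine ⟨compCLMOfContinuousLinearEquiv ℂ
    (ContinuousLinearEquiv.unitsEquivAut ℝ (Units.mk0 _ hs)) complexGaussian, fun u => ?_⟩
  rw [compCLMOfContinuousLinearEquiv_apply, Function.comp_apply, complexGaussian_apply]
  congr 3
  rw [ContinuousLinearEquiv.unitsEquivAut_apply, Units.val_mk0, mul_pow, inv_pow,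
    Real.sq_sqrt two_pos.le]
  ring

/-- Completeness within one component: the function `t^s exp (-t^(2r) / 2) S` has vanishing moments
in the injective variable `t^r`, and its factor in front of `S` is nonzero off the origin. -/
theorem ae_eq_zero_of_hermite_moments {r : ℕ} (hr : Odd r) {ν : ℝ} (hν : 0 < ν) (μ : ℝ) (s : ℕ)
    {S : ℝ → ℂ} (hS : MemLp S 2 (weightMeasure ν))
    (h : ∀ n, ∫ t : ℝ, (t : ℂ) ^ s * hermiteLadder μ n (t ^ r) * S t ∂weightMeasure ν = 0) :
    S =ᵐ[weightMeasure ν] 0 := by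
  have h0 : r ≠ 0 := hr.pos.ne'
  have hint : ∀ φ : 𝓢(ℝ, ℂ),
      Integrable (fun t : ℝ => (t : ℂ) ^ s * φ (t ^ r) * S t) (weightMeasure ν) := by
    intro φ
    obtain ⟨ψ, hψ⟩ := exists_pow_mul_comp_pow h0 s φ
    have := (ψ.memLp_weight hν).integrable_mul hS
    refine this.congr (Eventually.of_forall fun t => ?_)
    rw [Pi.mul_apply, hψ]
  let L : 𝓢(ℝ, ℂ) →ₗ[ℂ] ℂ :=
    { toFun := fun φ => ∫ t : ℝ, (t : ℂ) ^ s * φ (t ^ r) * S t ∂weightMeasure ν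
      map_add' := fun φ ψ => by
        rw [← integral_add (hint φ) (hint ψ)]
        refine integral_congr_ae (Eventually.of_forall fun t => ?_)
        simp only [add_apply]
        ring
      map_smul' := fun c φ => by
        rw [RingHom.id_apply, smul_eq_mul, ← integral_const_mul]
        refine integral_congr_ae (Eventually.of_forall fun t => ?_)
        simp only [smul_apply, smul_eq_mul]
        ring }
  have hL : Submodule.span ℂ (range (hermiteLadder μ)) ≤ LinearMap.ker L := by
    rw [Submodule.span_le]
    rintro _ ⟨n, rfl⟩
    exact h n
  have hmom : ∀ n : ℕ, ∫ t : ℝ, ((t ^ r : ℝ) : ℂ) ^ n *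
      ((t : ℂ) ^ s * complexGaussian (t ^ r) * S t) ∂weightMeasure ν = 0 := by
    intro n
    have h1 : L (mulX^[n] complexGaussian) = 0 := hL (mulX_iterate_mem_span μ n)
    refine Eq.trans (integral_congr_ae (Eventually.of_forall fun t => ?_)) h1
    simp only [mulX_iterate_apply]
    ring
  have hK := ae_eq_zero_of_moments (measurableEmbedding_pow hr) (fun c => ?_) hmom
  · filter_upwards [hK, ae_weightMeasure_ne_zero ν] with t ht ht0
    rw [Pi.zero_apply, mul_eq_zero, mul_eq_zero, complexGaussian_apply] at ht
    refine ht.resolve_left fun h1 => ?_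
    rcases h1 with h1 | h1
    · exact pow_ne_zero _ (Complex.ofReal_ne_zero.2 ht0) h1
    · exact (Real.exp_pos _).ne' (Complex.ofReal_eq_zero.1 h1)
  · obtain ⟨φ, hφ⟩ := exists_schwartz_exp_quarter
    refine ((hint φ).const_mul (Real.exp (c ^ 2) : ℂ)).mono ?_ (Eventually.of_forall fun t => ?_)
    · refine AEStronglyMeasurable.mul ?_ (hint complexGaussian).1
      exact (by fun_prop : Continuous fun t : ℝ =>
        ((Real.exp (c * |t ^ r|) : ℝ) : ℂ)).aestronglyMeasurable
    · rw [complexGaussian_apply, hφ]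
      -- Half of the Gaussian exponent absorbs `exp (c |u|)`, by `c |u| ≤ c² + u² / 4`; the other
      -- half is again a Schwartz function.
      have h1 : c * |t ^ r| + -((t ^ r) ^ 2 / 2) ≤ c ^ 2 + -((t ^ r) ^ 2 / 4) := by
        rw [← sq_abs (t ^ r)]
        nlinarith [sq_nonneg (c - |t ^ r| / 2)]
      have h2 := Real.exp_le_exp.2 h1
      rw [Real.exp_add, Real.exp_add] at h2
      simp only [norm_mul, Complex.norm_real, Real.norm_of_nonneg (Real.exp_pos _).le]
      have h3 : 0 ≤ ‖(t : ℂ) ^ s‖ * ‖S t‖ := by positivity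
      calc _ = (Real.exp (c * |t ^ r|) * Real.exp (-((t ^ r) ^ 2 / 2))) *
            (‖(t : ℂ) ^ s‖ * ‖S t‖) := by ring
        _ ≤ (Real.exp (c ^ 2) * Real.exp (-((t ^ r) ^ 2 / 4))) * (‖(t : ℂ) ^ s‖ * ‖S t‖) :=
            mul_le_mul_of_nonneg_right h2 h3
        _ = _ := by ring

/-! ### The Hermite basis of the Hilbert space -/

open SchwartzMap UnboundedOperator

/-- The bound on `ν` says exactly that `ν_0 > 0`, and `ν_s` increases with `s`. -/
theorem nuParam_pos {r : ℕ} (h0 : r ≠ 0) {ν : ℝ} (hν : ((r : ℝ) - 1) / 2 < ν) (s : ℕ) :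
    0 < nuParam r ν s := by
  have hr : (0 : ℝ) < r := by exact_mod_cast Nat.pos_of_ne_zero h0
  have hs : (0 : ℝ) ≤ s := s.cast_nonneg
  rw [nuParam]
  refine div_pos ?_ (by positivity)
  linarith

theorem pos_of_lt {r : ℕ} (h0 : r ≠ 0) {ν : ℝ} (hν : ((r : ℝ) - 1) / 2 < ν) : 0 < ν := by
  have hr : (1 : ℝ) ≤ r := by exact_mod_cast Nat.pos_of_ne_zero h0
  linarith

theorem energy_eq {r : ℕ} (h0 : r ≠ 0) (ν : ℝ) (N : ℕ) :
    energy r ν N = (N / r : ℕ) + 1 / 2 + nuParam r ν (N % r) := by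
  have h := deformedInt_add (nuParam r ν (N % r)) (N / r)
  have h1 : deformedNumber r ν (N + r) = deformedInt (nuParam r ν (N % r)) (N / r + 1) := by
    rw [deformedNumber, deformedInt, Nat.add_mod_right, Nat.add_div_right _ (Nat.pos_of_ne_zero h0)]
  have h2 : deformedNumber r ν N = deformedInt (nuParam r ν (N % r)) (N / r) := rfl
  rw [energy, h1, h2, h]
  ring

/-- The energies of all `r` components interlace to one arithmetic progression of step `1 / r`;
hence simplicity and uniform gaps. -/
theorem energy_eq_div {r : ℕ} (h0 : r ≠ 0) (ν : ℝ) (N : ℕ) :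
    energy r ν N = (N + ν + 1 / 2) / r := by
  have hr : (r : ℝ) ≠ 0 := by exact_mod_cast h0
  have h : (N : ℝ) = r * (N / r : ℕ) + (N % r : ℕ) := by exact_mod_cast (Nat.div_add_mod N r).symm
  rw [energy_eq h0, nuParam, eq_div_iff hr]
  rw [h]
  field_simp
  ring

theorem le_abs_energy_sub {r : ℕ} (h0 : r ≠ 0) (ν : ℝ) {n m : ℕ} (h : n ≠ m) :
    1 / (r : ℝ) ≤ |energy r ν n - energy r ν m| := by
  have hr : (0 : ℝ) < r := by exact_mod_cast Nat.pos_of_ne_zero h0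
  have h1 : energy r ν n - energy r ν m = (((n : ℤ) - m : ℤ) : ℝ) / r := by
    rw [energy_eq_div h0, energy_eq_div h0]
    push_cast
    ring
  have h2 : (1 : ℝ) ≤ |(((n : ℤ) - m : ℤ) : ℝ)| := by
    have h3 : (1 : ℤ) ≤ |(n : ℤ) - m| := Int.one_le_abs (sub_ne_zero.2 (by exact_mod_cast h))
    rw [← Int.cast_abs, ← Int.cast_one]
    exact Int.cast_le.2 h3
  rw [h1, abs_div, abs_of_pos hr]
  gcongr

theorem weightedPairing_hermiteLadder_eq_normSq {r : ℕ} (h0 : r ≠ 0) {ν : ℝ}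
    (hν : ((r : ℝ) - 1) / 2 < ν) (N : ℕ) :
    weightedPairing (nuParam r ν (N % r)) (hermiteLadder (nuParam r ν (N % r)) (N / r))
      (hermiteLadder (nuParam r ν (N % r)) (N / r)) = (hermiteNormSq r ν N : ℂ) := by
  have h1 : N / (2 * r) = N / r / 2 := by rw [Nat.div_div_eq_div_mul, mul_comm]
  have h2 : (N + r) / (2 * r) = (N / r + 1) / 2 := by
    rw [← Nat.add_div_right _ (Nat.pos_of_ne_zero h0), Nat.div_div_eq_div_mul, mul_comm]
  rw [weightedPairing_hermiteLadder_self (nuParam_pos h0 hν _), hermiteNormSq, h1, h2]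

theorem hermiteNormSq_pos {r : ℕ} (h0 : r ≠ 0) {ν : ℝ} (hν : ((r : ℝ) - 1) / 2 < ν) (N : ℕ) :
    0 < hermiteNormSq r ν N := by
  have h1 := nuParam_pos h0 hν (N % r)
  rw [hermiteNormSq]
  have h2 := Real.Gamma_pos_of_pos (show (0 : ℝ) < (N / (2 * r) : ℕ) + 1 by positivity)
  have h3 := Real.Gamma_pos_of_pos
    (show (0 : ℝ) < ((N + r) / (2 * r) : ℕ) + nuParam r ν (N % r) + 1 / 2 by positivity)
  positivity

theorem hermiteConst_mul_self {r : ℕ} (h0 : r ≠ 0) {ν : ℝ} (hν : ((r : ℝ) - 1) / 2 < ν) (N : ℕ) :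
    hermiteConst r ν N * hermiteConst r ν N * hermiteNormSq r ν N = 1 := by
  have h := hermiteNormSq_pos h0 hν N
  have h1 := Real.mul_self_sqrt h.le
  have h2 := (Real.sqrt_pos.2 h).ne'
  rw [hermiteConst]
  nth_rw 3 [← h1]
  field_simp

section

variable {r : ℕ} (hr : Odd r) {ν : ℝ} (hν : ((r : ℝ) - 1) / 2 < ν)

/-- The class of the Hermite function in `L²`. -/
noncomputable def hermiteLp (N : ℕ) : L2 r ν :=
  (memLp_hermiteFunction hr.pos.ne' (pos_of_lt hr.pos.ne' hν) N).toLp _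

theorem coeFn_hermiteLp (N : ℕ) :
    (hermiteLp hr hν N : ℂ → ℂ) =ᵐ[lineMeasure r ν] hermiteFunction r ν N :=
  MemLp.coeFn_toLp _

theorem inner_hermiteLp (N : ℕ) {F : L2 r ν} {f : ℂ → ℂ} (hF : (F : ℂ → ℂ) =ᵐ[lineMeasure r ν] f) :
    inner ℂ (hermiteLp hr hν N) F =
      ∫ x, (starRingEnd ℂ) (hermiteFunction r ν N x) * f x ∂lineMeasure r ν := by
  rw [L2.inner_def]
  refine integral_congr_ae ?_
  filter_upwards [hF, coeFn_hermiteLp hr hν N] with x h1 h2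
  rw [h1, h2, RCLike.inner_apply, mul_comm]

theorem inner_hermiteLp_of_hasComponents (N : ℕ) {F : L2 r ν} {f : ℂ → ℂ} {Φ : ℕ → 𝓢(ℝ, ℂ)}
    (hF : (F : ℂ → ℂ) =ᵐ[lineMeasure r ν] f) (hf : HasComponents r f Φ) :
    inner ℂ (hermiteLp hr hν N) F = (hermiteConst r ν N : ℂ) *
      weightedPairing (nuParam r ν (N % r)) (hermiteLadder (nuParam r ν (N % r)) (N / r))
        (Φ (N % r)) := by
  rw [inner_hermiteLp hr hν N hF, integral_conj_hermiteFunction_mul_of_hasComponents hr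
    (pos_of_lt hr.pos.ne' hν) N (nuParam_pos hr.pos.ne' hν _) hf]

theorem orthonormal_hermiteLp : Orthonormal ℂ (hermiteLp hr hν) := by
  have h0 : r ≠ 0 := hr.pos.ne'
  rw [orthonormal_iff_ite]
  intro N M
  rw [inner_hermiteLp_of_hasComponents hr hν N (coeFn_hermiteLp hr hν M)
    (hasComponents_hermiteFunction h0 ν M), hermiteComponents]
  by_cases hs : N % r = M % r
  · rw [if_pos hs, weightedPairing_comm, weightedPairing_smul_left, hs, weightedPairing_comm]
    split_ifs with h
    · subst h
      rw [weightedPairing_hermiteLadder_eq_normSq h0 hν]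
      have := hermiteConst_mul_self h0 hν N
      rw [← mul_assoc]
      exact_mod_cast this
    · have hne : N / r ≠ M / r := fun h1 => h <| by
        rw [← Nat.div_add_mod N r, ← Nat.div_add_mod M r, hs, h1]
      rw [weightedPairing_hermiteLadder_of_ne (nuParam_pos h0 hν _) hne, mul_zero, mul_zero]
  · rw [if_neg hs, if_neg fun h => hs (by rw [h])]
    simp [weightedPairing]

/-- The indices `N = r n + s` with fixed `s` see only the sector projection of index `s`, which
therefore vanishes; Fourier inversion over the rotations reassembles `F`. -/
theorem eq_zero_of_inner_hermiteLp {F : L2 r ν} (h : ∀ N, inner ℂ (hermiteLp hr hν N) F = 0) :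
    F = 0 := by
  have h0 : r ≠ 0 := hr.pos.ne'
  have hν0 := pos_of_lt h0 hν
  have hF := Lp.memLp F
  have hS : ∀ s ∈ Finset.range r,
      (fun t : ℝ => sectorProj r s F t) =ᵐ[weightMeasure ν] 0 := by
    intro s hs
    have hs' := Finset.mem_range.1 hs
    refine ae_eq_zero_of_hermite_moments hr hν0 (nuParam r ν s) s (memLp_sectorProj h0 hF s)
      fun n => ?_
    have h1 := h (r * n + s)
    have e1 : (r * n + s) % r = s := by rw [Nat.mul_add_mod, Nat.mod_eq_of_lt hs']
    have e2 : (r * n + s) / r = n := by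
      rw [Nat.mul_add_div hr.pos, Nat.div_eq_of_lt hs', add_zero]
    rw [inner_hermiteLp hr hν _ (EventuallyEq.refl _ _),
      integral_conj_hermiteFunction_mul h0 hν0 _ hF, e1, e2, mul_eq_zero, mul_eq_zero] at h1
    refine (h1.resolve_left fun h2 => ?_).resolve_left (by exact_mod_cast h0)
    have h3 := hermiteConst_mul_self h0 hν (r * n + s)
    rw [Complex.ofReal_eq_zero.1 h2] at h3
    simp at h3
  refine (Lp.eq_zero_iff_ae_eq_zero).2 ((ae_lineMeasure_iff h0 ν).2 fun k hk => ?_)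
  filter_upwards [(Finset.eventually_all (Finset.range r)).2 hS] with t ht
  rw [← sum_omega_mul_sectorProj h0 F t hk, Pi.zero_apply]
  refine Finset.sum_eq_zero fun s hs => ?_
  have := ht s hs
  rw [Pi.zero_apply] at this
  rw [this, mul_zero]

/-- The Hilbert basis of Hermite functions. -/
noncomputable def hermiteBasis : HilbertBasis ℕ ℂ (L2 r ν) :=
  HilbertBasis.mkOfOrthogonalEqBot (orthonormal_hermiteLp hr hν) <| by
    rw [Submodule.eq_bot_iff]
    intro F hF
    refine eq_zero_of_inner_hermiteLp hr hν fun N => ?_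
    exact (Submodule.mem_orthogonal _ _).1 hF _ (Submodule.subset_span ⟨N, rfl⟩)

theorem hermiteBasis_apply (N : ℕ) : hermiteBasis hr hν N = hermiteLp hr hν N := by
  rw [hermiteBasis, HilbertBasis.coe_mkOfOrthogonalEqBot]

/-! ### The Hamiltonian and its closure -/

/-- The Hamiltonian is diagonal in the Hermite basis. -/
theorem mem_diagonalGraph_of_ae_eq {f : ℂ → ℂ} (hf : f ∈ schwartzSpace r) {F G : L2 r ν}
    (hF : (F : ℂ → ℂ) =ᵐ[lineMeasure r ν] f)
    (hG : (G : ℂ → ℂ) =ᵐ[lineMeasure r ν] hamiltonianExpr r ν f) :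
    (F, G) ∈ diagonalGraph (hermiteBasis hr hν) (energy r ν) := by
  have h0 : r ≠ 0 := hr.pos.ne'
  obtain ⟨Φ, hΦ⟩ := exists_hasComponents hr hf
  intro N
  rw [HilbertBasis.repr_apply_apply, HilbertBasis.repr_apply_apply, hermiteBasis_apply,
    inner_hermiteLp_of_hasComponents hr hν N hF hΦ,
    inner_hermiteLp_of_hasComponents hr hν N hG (hΦ.hamiltonianExpr h0 ν),
    ← weightedPairing_oscillator (nuParam_pos h0 hν _), oscillator_hermiteLadder,
    weightedPairing_smul_left, energy_eq h0]
  ring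

/-- The classes of the functions in the Schwartz space. -/
def schwartzClasses (r : ℕ) (ν : ℝ) : Submodule ℂ (L2 r ν) where
  carrier := {F | ∃ f ∈ schwartzSpace r, (F : ℂ → ℂ) =ᵐ[lineMeasure r ν] f}
  zero_mem' := ⟨0, Submodule.zero_mem _, Lp.coeFn_zero _ _ _⟩
  add_mem' := by
    rintro F G ⟨f, hf, hF⟩ ⟨g, hg, hG⟩
    exact ⟨f + g, Submodule.add_mem _ hf hg, (Lp.coeFn_add F G).trans (hF.add hG)⟩
  smul_mem' := by
    rintro c F ⟨f, hf, hF⟩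
    exact ⟨c • f, Submodule.smul_mem _ c hf, (Lp.coeFn_smul c F).trans (hF.const_smul c)⟩

/-- Restricting the maximal diagonal operator to the Schwartz classes gives linearity and
independence of the representative at once. -/
theorem exists_isHamiltonian {r : ℕ} (hr : Odd r) {ν : ℝ} (hν : ((r : ℝ) - 1) / 2 < ν) :
    ∃ H : L2 r ν →ₗ.[ℂ] L2 r ν, IsHamiltonian r ν H := by
  have h0 : r ≠ 0 := hr.pos.ne'
  have hν0 := pos_of_lt h0 hν
  refine ⟨(diagonalOp (hermiteBasis hr hν) (energy r ν)).domRestrict (schwartzClasses r ν),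
    fun F hF => hF.1, fun f hf => ?_⟩
  obtain ⟨Φ, hΦ⟩ := exists_hasComponents hr hf
  have hF := (hΦ.memLp h0 hν0).coeFn_toLp
  have hG := ((hΦ.hamiltonianExpr h0 ν).memLp h0 hν0).coeFn_toLp
  -- The domain of `domRestrict` is an intersection; this shows that no Schwartz class is lost.
  have hmem := mem_diagonalGraph_of_ae_eq hr hν hf hF hG
  rw [← diagonalOp_graph] at hmem
  have hdom := LinearPMap.mem_domain_of_mem_graph hmem
  have hsc : (hΦ.memLp h0 hν0).toLp f ∈ schwartzClasses r ν := ⟨f, hf, hF⟩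
  have hval : (diagonalOp (hermiteBasis hr hν) (energy r ν)).domRestrict (schwartzClasses r ν)
      ⟨_, hsc, hdom⟩ = ((hΦ.hamiltonianExpr h0 ν).memLp h0 hν0).toLp _ :=
    (LinearPMap.domRestrict_apply (y := ⟨_, hdom⟩) rfl).trans
      (LinearPMap.mem_graph_snd_inj _ (LinearPMap.mem_graph _ ⟨_, hdom⟩) hmem rfl)
  refine ⟨⟨_, hsc, hdom⟩, hF, ?_⟩
  rw [hval]
  exact hG

theorem IsHamiltonian.graph_le {H H' : L2 r ν →ₗ.[ℂ] L2 r ν} (h : IsHamiltonian r ν H)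
    (h' : IsHamiltonian r ν H') : H.graph ≤ H'.graph := by
  rintro ⟨x, y⟩ hxy
  rw [LinearPMap.mem_graph_iff] at hxy
  obtain ⟨F, rfl, rfl⟩ := hxy
  obtain ⟨f, hf, hF⟩ := h.domain_le F F.2
  obtain ⟨G, hG, hHG⟩ := h.acts f hf
  obtain ⟨G', hG', hHG'⟩ := h'.acts f hf
  have e1 : G = F := Subtype.ext (Lp.ext (hG.trans hF.symm))
  have e2 : (G' : L2 r ν) = F := Lp.ext (hG'.trans hF.symm)
  subst e1
  rw [LinearPMap.mem_graph_iff]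
  exact ⟨G', e2, Lp.ext (hHG'.trans hHG.symm)⟩

theorem IsHamiltonian.graph_le_diagonalGraph {H : L2 r ν →ₗ.[ℂ] L2 r ν}
    (h : IsHamiltonian r ν H) : H.graph ≤ diagonalGraph (hermiteBasis hr hν) (energy r ν) := by
  rintro ⟨x, y⟩ hxy
  rw [LinearPMap.mem_graph_iff] at hxy
  obtain ⟨F, rfl, rfl⟩ := hxy
  obtain ⟨f, hf, hF⟩ := h.domain_le F F.2
  obtain ⟨G, hG, hHG⟩ := h.acts f hf
  have e1 : G = F := Subtype.ext (Lp.ext (hG.trans hF.symm))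
  subst e1
  exact mem_diagonalGraph_of_ae_eq hr hν hf hG hHG

/-- The eigenvalue equation is read off from coordinates: the diagonal graph prescribes those of `H
h_N`, so the differential expression need not be applied to `h_N`. -/
theorem IsHamiltonian.hermiteBasis_mem_graph {H : L2 r ν →ₗ.[ℂ] L2 r ν}
    (h : IsHamiltonian r ν H) (N : ℕ) :
    (hermiteBasis hr hν N, (energy r ν N : ℂ) • hermiteBasis hr hν N) ∈ H.graph := by
  obtain ⟨G, hG, -⟩ := h.acts _ (hermiteFunction_mem_schwartzSpace hr.pos.ne' ν N)
  have e1 : (G : L2 r ν) = hermiteBasis hr hν N := by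
    rw [hermiteBasis_apply]
    exact Lp.ext (hG.trans (coeFn_hermiteLp hr hν N).symm)
  have h1 := h.graph_le_diagonalGraph hr hν (H.mem_graph G)
  have h2 := basis_mem_diagonalGraph (hermiteBasis hr hν) (energy r ν) N
  have h3 : H G = (energy r ν N : ℂ) • hermiteBasis hr hν N :=
    eq_of_repr_eq (hermiteBasis hr hν) fun n => by rw [h1 n, h2 n, e1]
  have h4 := H.mem_graph G
  rwa [h3, e1] at h4

end

end RadialLines

theorem theorem4p4 (r : ℕ) (hr : Odd r) (ν : ℝ) (hν : ((r : ℝ) - 1) / 2 < ν) :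
    (∃! H : RadialLines.L2 r ν →ₗ.[ℂ] RadialLines.L2 r ν, RadialLines.IsHamiltonian r ν H) ∧
    ∀ H : RadialLines.L2 r ν →ₗ.[ℂ] RadialLines.L2 r ν, RadialLines.IsHamiltonian r ν H →
      UnboundedOperator.IsEssentiallySelfAdjoint H ∧
      UnboundedOperator.HasPurelyDiscreteSpectrum H.closure ∧
      UnboundedOperator.spectrum H.closure =
        Set.range (fun N : ℕ => ((RadialLines.energy r ν N : ℝ) : ℂ)) ∧
      ∃ h : HilbertBasis ℕ ℂ (RadialLines.L2 r ν),
        (∀ N, ((h N : RadialLines.L2 r ν) : ℂ → ℂ)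
          =ᵐ[RadialLines.lineMeasure r ν] RadialLines.hermiteFunction r ν N) ∧
        (∀ N, ∃ hN : h N ∈ H.domain,
          H ⟨h N, hN⟩ = ((RadialLines.energy r ν N : ℝ) : ℂ) • h N) ∧
        ∀ N, UnboundedOperator.eigenspace H.closure ((RadialLines.energy r ν N : ℝ) : ℂ) =
          Submodule.span ℂ {h N} := by
  have h0 : r ≠ 0 := hr.pos.ne'
  constructor
  · obtain ⟨H, hH⟩ := RadialLines.exists_isHamiltonian hr hν
    exact ⟨H, hH, fun H' hH' =>
      LinearPMap.eq_of_eq_graph (le_antisymm (hH'.graph_le hH) (hH.graph_le hH'))⟩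
  · intro H hH
    have hle := hH.graph_le_diagonalGraph hr hν
    have hmem := hH.hermiteBasis_mem_graph hr hν
    -- The closure is the maximal diagonal operator; its spectrum and eigenspaces are then those of
    -- a diagonal operator with gaps at least `1 / r`.
    have hg := UnboundedOperator.closure_graph_eq_diagonalGraph hle hmem
    have hc : (0 : ℝ) < 1 / r := by
      have : (0 : ℝ) < r := by exact_mod_cast hr.pos
      positivity
    have hsep : ∀ n m, n ≠ m →
        1 / (r : ℝ) ≤ |RadialLines.energy r ν n - RadialLines.energy r ν m| :=
      fun n m h => RadialLines.le_abs_energy_sub h0 ν h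
    have hinj : Function.Injective (RadialLines.energy r ν) := fun n m h => by
      by_contra hne
      have := hsep n m hne
      rw [h, sub_self, abs_zero] at this
      linarith
    refine ⟨UnboundedOperator.isEssentiallySelfAdjoint_of_diagonal hle hmem,
      UnboundedOperator.hasPurelyDiscreteSpectrum_of_diagonal hg hc hsep,
      UnboundedOperator.spectrum_eq_range hg hc hsep, RadialLines.hermiteBasis hr hν,
      fun N => ?_, fun N => ?_, fun N => UnboundedOperator.eigenspace_eq_span hg hinj N⟩
    · rw [RadialLines.hermiteBasis_apply]
      exact RadialLines.coeFn_hermiteLp hr hν N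
    · have hd := LinearPMap.mem_domain_of_mem_graph (hmem N)
      exact ⟨hd, LinearPMap.mem_graph_snd_inj _ (LinearPMap.mem_graph _ ⟨_, hd⟩) (hmem N) rfl⟩
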